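/- Let $M,N\in\mathbb Z\cup\{\infty\}$ be such that $E=\{i\in\mathbb Z:-M-1<i<N+1\}$ is non-empty, let $a_i>0$ and $b_i>0$ $(i\in E)$ be death and birth rates, and fix a reference point $\theta\in E$. Put $\mu_\theta=\frac1{a_\theta b_\theta}$ and $$\mu_i=\frac{\prod_{\theta<k<i}b_k}{\prod_{\theta\le k\le i}a_k}\quad(i\in E,\ i>\theta),\qquad \mu_i=\frac{\prod_{i<k<\theta}a_k}{\prod_{i\le k\le\theta}b_k}\quad(i\in E,\ i<\theta).$$ For $f:E\to\mathbb R$, extended by the Dirichlet boundary condition $f_{-M-1}=0$ if $M<\infty$ and $f_{N+1}=0$ if $N<\infty$, let $$D(f)=\sum_{-M-1<i\le\theta}\mu_ia_i(f_i-f_{i-1})^2+\sum_{\theta\le i<N+1}\mu_ib_i(f_{i+1}-f_i)^2 .$$ Let $\mathscr D^{\min}(D)$ be the closure of the set of functions with finite support with respect to the norm $\|f\|_D=\big(\sum_{i\in E}\mu_if_i^2+D(f)\big)^{1/2}$; this is the domain of the Dirichlet form of the minimal birth–death process. Let $(\mathbb B,\|\cdot\|_{\mathbb B},\mu)$ be a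 normed linear space of real functions on $E$ such that - (H1) $\mathbb 1_K\in\mathbb B$ for every finite (i.e. compact) $K\subset E$ if $\mu(E)=\infty$, and $1\in\mathbb B$ if $\mu(E)<\infty$; - (H2) if $h\in\mathbb B$ and $|f|\le h$, then $f\in\mathbb B$; - (H3) $\|f\|_{\mathbb B}=\sup_{g\in\mathscr G}\int_E|f|\,g\,d\mu$ for a class $\mathscr G$ of nonnegative functions on $E$. For functions $f\notin\mathbb B$, $\|f\|_{\mathbb B}\in[0,\infty]$ is defined by the formula in (H3). Assume that $\mathscr G$ contains a locally positive element, i.e. some $g$ with $\inf_Kg>0$ for every non-empty finite $K\subset E$. Then the optimal constant $A_{\mathbb B}\in[0,\infty]$ in the Poincaré-type inequality $$\|f^2\|_{\mathbb B}\le A_{\mathbb B}\,D(f),\qquad f\in\mathscr D^{\min}(D)$$ (with $A_{\mathbb B}=\infty$ if there is no finite constant) satisfies $$B_{\mathbb B}\le A_{\mathbb B}\le 4B_{\mathbb B},$$ where, with the conventions $1/\infty=0$ and $1/0=\infty$, $$B_{\mathbb B}^{-1}=\inf_{m,n\in E:\,m\le n}\bigg[\bigg(\sum_{i=-M}^m\frac1{\mu_ia_i}\bigg)^{-1}+\bigg(\sum_{i=n}^N\frac1{\mu_ib_i}\bigg)^{-1}\bigg]\,\|\mathbb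 1_{[m,n]}\|_{\mathbb B}^{-1}.$$ In particular, for every real $p\ge2$ this applies to $\mathbb B=L^{p/2}(\mu)$ (which satisfies (H1)–(H3) for a class $\mathscr G$ containing a locally positive element), and then $B_{\mathbb B}=B_p$, where $$B_p^{-1}=\inf_{m,n\in E:\,m\le n}\bigg[\bigg(\sum_{i=-M}^m\frac1{\mu_ia_i}\bigg)^{-1}+\bigg(\sum_{i=n}^N\frac1{\mu_ib_i}\bigg)^{-1}\bigg]\bigg(\sum_{j=m}^n\mu_j\bigg)^{-2/p};$$ thus the optimal constant $A_p$ in the Sobolev-type inequality $\|f^2\|_{L^{p/2}(\mu)}\le A_p\,D(f)$, $f\in\mathscr D^{\min}(D)$, satisfies $B_p\le A_p\le4B_p$. -/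

import Mathlib

open MeasureTheory
open scoped ENNReal NNReal

noncomputable section

namespace BirthDeath

/-- A normed linear space `𝔹` of real measurable functions on `(X, μ)` whose norm has the dual
form `‖f‖ = sup_{g ∈ 𝒢} ∫ |f| g dμ` for a class `𝒢` of nonnegative measurable functions, which is
solid, and which contains the indicators of compact sets, and even the constant `1` if `μ` is
finite. -/
structure FunctionSpace (X : Type*) [TopologicalSpace X] [MeasurableSpace X] (μ : Measure X) where
  /-- the underlying linear space of functions -/
  carrier : Submodule ℝ (X → ℝ)
  /-- the norm -/
  nrm : Seminorm ℝ carrier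
  /-- the class `𝒢` -/
  dual : Set (X → ℝ≥0)
  measurable_of_mem : ∀ f ∈ carrier, Measurable f
  measurable_of_mem_dual : ∀ g ∈ dual, Measurable g
  ae_eq_zero_of_nrm_eq_zero : ∀ f : carrier, nrm f = 0 → (f : X → ℝ) =ᵐ[μ] 0
  indicator_mem : μ Set.univ = ∞ → ∀ K : Set X, IsCompact K → K.indicator (fun _ => (1 : ℝ)) ∈ carrier
  one_mem : μ Set.univ ≠ ∞ → (fun _ => (1 : ℝ)) ∈ carrier
  solid : ∀ h ∈ carrier, ∀ f : X → ℝ, Measurable f → (∀ x, |f x| ≤ h x) → f ∈ carrier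
  nrm_eq : ∀ f : carrier, ENNReal.ofReal (nrm f) = ⨆ g ∈ dual, ∫⁻ x, ‖(f : X → ℝ) x‖ₑ * g x ∂μ

namespace FunctionSpace

variable {X : Type*} [TopologicalSpace X] [MeasurableSpace X] {μ : Measure X}

/-- The quantity `‖f‖ = sup_{g ∈ 𝒢} ∫ |f| g dμ ∈ [0, ∞]` for an arbitrary function `f`; it is the
norm of `f` if `f` belongs to the space. -/
def extNorm (B : FunctionSpace X μ) (f : X → ℝ) : ℝ≥0∞ :=
  ⨆ g ∈ B.dual, ∫⁻ x, ‖f x‖ₑ * g x ∂μ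

/-- The class `𝒢` contains an element that is bounded below by a positive constant on every
compact set. -/
def HasLocallyPositive (B : FunctionSpace X μ) : Prop :=
  ∃ g ∈ B.dual, ∀ K : Set X, IsCompact K → ∃ c : ℝ≥0, 0 < c ∧ ∀ x ∈ K, c ≤ g x

/-- The space is `L^q(μ)`, with its usual norm. -/
def IsLp (B : FunctionSpace X μ) (q : ℝ≥0∞) : Prop :=
  (∀ f : X → ℝ, f ∈ B.carrier ↔ Measurable f ∧ eLpNorm f q μ < ∞) ∧
    ∀ f : B.carrier, ENNReal.ofReal (B.nrm f) = eLpNorm (f : X → ℝ) q μ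

end FunctionSpace

/-- The state space `{i ∈ ℤ : -M - 1 < i < N + 1}`; each of `M`, `N` is an integer or `∞`. -/
def stateSpace (M N : WithTop ℤ) : Set ℤ :=
  {i | ((-i : ℤ) : WithTop ℤ) < M + 1 ∧ (i : WithTop ℤ) < N + 1}

variable {M N : WithTop ℤ}

/-- The symmetric measure `(μ_i)` of the process with death rates `a` and birth rates `b`,
relative to the reference point `θ`. -/
def weight (a b : ℤ → ℝ) (θ i : ℤ) : ℝ :=
  if i = θ then 1 / (a θ * b θ)
  else if θ < i then (∏ k ∈ Finset.Ioo θ i, b k) / ∏ k ∈ Finset.Icc θ i, a k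
  else (∏ k ∈ Finset.Ioo i θ, a k) / ∏ k ∈ Finset.Icc i θ, b k

/-- `(μ_i)` as a measure on the state space. -/
def symMeasure (a b : ℤ → ℝ) (θ : stateSpace M N) : Measure (stateSpace M N) :=
  Measure.sum fun i : stateSpace M N => ENNReal.ofReal (weight a b θ i) • Measure.dirac i

open Classical in
/-- Dirichlet boundary condition: `f` is extended by `0` outside of the state space. -/
def zeroExt (f : stateSpace M N → ℝ) (i : ℤ) : ℝ :=
  if h : i ∈ stateSpace M N then f ⟨i, h⟩ else 0

/-- The Dirichlet form
`D(f) = ∑_{i ≤ θ} μ_i a_i (f_i - f_{i-1})² + ∑_{i ≥ θ} μ_i b_i (f_{i+1} - f_i)²`. -/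
def dirichletForm (a b : ℤ → ℝ) (θ : stateSpace M N) (f : stateSpace M N → ℝ) : ℝ≥0∞ :=
  (∑' i : Set.Iic θ,
      ENNReal.ofReal (weight a b θ i * a i * (zeroExt f i - zeroExt f ((i : ℤ) - 1)) ^ 2)) +
    ∑' i : Set.Ici θ,
      ENNReal.ofReal (weight a b θ i * b i * (zeroExt f ((i : ℤ) + 1) - zeroExt f i) ^ 2)

/-- The domain of the minimal Dirichlet form: the closure of the functions with finite support
for the norm `‖f‖_D² = ∑ μ_i f_i² + D(f)`. -/
def minimalDomain (a b : ℤ → ℝ) (θ : stateSpace M N) : Set (stateSpace M N → ℝ) :=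
  {f | ∀ ε : ℝ≥0∞, 0 < ε → ∃ h : stateSpace M N → ℝ, (Function.support h).Finite ∧
    (∫⁻ i, ENNReal.ofReal ((f i - h i) ^ 2) ∂(symMeasure a b θ)) +
      dirichletForm a b θ (f - h) < ε}

/-- The optimal constant `A` in `‖f²‖ ≤ A D(f)` for `f` in the minimal domain, where `‖·‖` is
given by `Φ`. It is `∞` if the inequality holds with no finite constant. -/
def optimalConst (a b : ℤ → ℝ) (θ : stateSpace M N) (Φ : (stateSpace M N → ℝ) → ℝ≥0∞) : ℝ≥0∞ :=
  sInf {A | ∀ f ∈ minimalDomain a b θ, Φ (fun i => f i ^ 2) ≤ A * dirichletForm a b θ f}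

/-- `(∑_{i=-M}^m 1/(μ_i a_i))⁻¹ + (∑_{i=n}^N 1/(μ_i b_i))⁻¹`, with the convention `1/∞ = 0`. -/
def conductance (a b : ℤ → ℝ) (θ m n : stateSpace M N) : ℝ≥0∞ :=
  (∑' i : Set.Iic m, ENNReal.ofReal (1 / (weight a b θ i * a i)))⁻¹ +
    (∑' i : Set.Ici n, ENNReal.ofReal (1 / (weight a b θ i * b i)))⁻¹

/-- The isoperimetric constant of a function space. -/
def isoConst (a b : ℤ → ℝ) (θ : stateSpace M N)
    (B : FunctionSpace (stateSpace M N) (symMeasure a b θ)) : ℝ≥0∞ :=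
  (⨅ (m : stateSpace M N) (n : stateSpace M N) (_ : m ≤ n),
    conductance a b θ m n * (B.extNorm ((Set.Icc m n).indicator fun _ => (1 : ℝ)))⁻¹)⁻¹

/-- The isoperimetric constant of the Sobolev-type inequality with exponent `p`. -/
def sobolevIsoConst (a b : ℤ → ℝ) (θ : stateSpace M N) (p : ℝ) : ℝ≥0∞ :=
  (⨅ (m : stateSpace M N) (n : stateSpace M N) (_ : m ≤ n),
    conductance a b θ m n *
      (∑ j ∈ Finset.Icc (m : ℤ) (n : ℤ), ENNReal.ofReal (weight a b θ j)) ^ (-(2 / p)))⁻¹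

end BirthDeath

end

noncomputable section

namespace BirthDeath

variable {M N : WithTop ℤ}

/-! The chain is an electrical network on a line: the edge `{j - 1, j}` has conductance `μ_j a_j =
μ_{j-1} b_{j-1}` (detailed balance), `D(f)` is the energy of the potential `f`, and `conductance` is
the capacity of `[m, n]` relative to the grounded boundary. The theorem compares a Poincaré-type
inequality with its restriction to intervals, that is, norm against capacity.

Lower bound: the test function that equals `1` on `[m, n]` and falls off on both sides in proportion
to resistance has the capacity as its energy. It is first built on finite networks
(`exists_testFunction`), and the limit is taken in `le_mul_conductance`.

Upper bound: for a fixed `g ∈ 𝒢` the norm becomes a sum with weights `W = μ g`, and `W [m, n] ≤ C ·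
conductance` holds with `C` the isoperimetric constant. Let `f` have finite support and let `s` be a
peak of `f²`. The level set `{f² ≥ t}` lies between the first points, coming from the left and from
the right, where `f²` reaches `t`. These points lie on opposite sides of `s`, so the capacity of the
interval splits into a left and a right term. Integrated over `t`, each is at most `4` times the
energy on its own side, by a Hardy inequality for the running maximum (`hardy_runMax`,
`exists_layer`); this is the source of the factor `4`. The layer-cake formula concludes
(`tsum_sq_mul_le`), and approximation reaches the minimal domain. -/

/-! ### Hardy's inequality along one branch -/

/-- One step of Hardy's inequality, with `y² / L` as the potential that telescopes. The difference
of the two sides is a quadratic form in `(y, z)`, and completing the square makes its sign visible.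
-/
lemma hardy_step_real {y z L r : ℝ} (hL : 0 < L) (hr : 0 < r) :
    (z ^ 2 - y ^ 2) / (L + r) + z ^ 2 / (L + r) ≤ 4 * (1 / r * (z - y) ^ 2) + y ^ 2 / L := by
  have h : 4 * (1 / r * (z - y) ^ 2) + y ^ 2 / L - ((z ^ 2 - y ^ 2) / (L + r) + z ^ 2 / (L + r)) =
      (2 * L * ((2 * L + r) * z - 2 * (L + r) * y) ^ 2 + r ^ 3 * y ^ 2) /
        (r * L * (L + r) * (2 * L + r)) := by
    field_simp
    ring
  rw [← sub_nonneg, h]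
  positivity

lemma hardy_step {y z : ℝ} (hy : 0 ≤ y) (hyz : y ≤ z) (L : ℝ≥0∞) {c : ℝ} (hc : 0 < c) :
    ENNReal.ofReal (z ^ 2 - y ^ 2) * (L + ENNReal.ofReal (1 / c))⁻¹ +
        ENNReal.ofReal (z ^ 2) * (L + ENNReal.ofReal (1 / c))⁻¹ ≤
      4 * ENNReal.ofReal (c * (z - y) ^ 2) + ENNReal.ofReal (y ^ 2) * L⁻¹ := by
  have hyz2 : 0 ≤ z ^ 2 - y ^ 2 := by nlinarith
  have h4 : (4 : ℝ≥0∞) = ENNReal.ofReal 4 := by norm_num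
  rcases eq_or_ne L ∞ with rfl | hL
  · simp
  lift L to ℝ≥0 using hL
  -- At `L = 0` the last term is `∞` unless `y = 0`, and then only `2 c z² ≤ 4 c z²` remains.
  rcases eq_or_ne L 0 with rfl | hL
  · rcases hy.eq_or_lt with rfl | hy0
    · rw [h4, ← ENNReal.ofReal_mul (by norm_num), ENNReal.coe_zero, zero_add,
        ← ENNReal.ofReal_inv_of_pos (by positivity), ← ENNReal.ofReal_mul hyz2,
        ← ENNReal.ofReal_mul (by positivity), ← ENNReal.ofReal_add (by positivity) (by positivity)]
      refine le_add_right (ENNReal.ofReal_le_ofReal ?_)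
      have : 0 ≤ c * z ^ 2 := by positivity
      simp only [one_div, inv_inv]
      nlinarith
    · have : ENNReal.ofReal (y ^ 2) ≠ 0 := by simp; positivity
      simp [ENNReal.mul_top this]
  · have hL0 : 0 < (L : ℝ) := by positivity
    rw [h4, ← ENNReal.ofReal_mul (by norm_num), ← ENNReal.ofReal_coe_nnreal (p := L),
      ← ENNReal.ofReal_add hL0.le (by positivity), ← ENNReal.ofReal_inv_of_pos (by positivity),
      ← ENNReal.ofReal_inv_of_pos hL0, ← ENNReal.ofReal_mul hyz2,
      ← ENNReal.ofReal_mul (by positivity), ← ENNReal.ofReal_mul (by positivity),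
      ← ENNReal.ofReal_add (by positivity) (by positivity),
      ← ENNReal.ofReal_add (by positivity) (by positivity)]
    refine ENNReal.ofReal_le_ofReal ?_
    simpa [div_eq_mul_inv] using hardy_step_real (y := y) (z := z) hL0 (one_div_pos.2 hc)

/-- The running maximum of the squares of a sequence. -/
def runMax (x : ℕ → ℝ) : ℕ → ℝ
  | 0 => x 0 ^ 2
  | n + 1 => max (runMax x n) (x (n + 1) ^ 2)

lemma sq_le_runMax (x : ℕ → ℝ) {k n : ℕ} (h : k ≤ n) : x k ^ 2 ≤ runMax x n := by
  induction n with
  | zero => obtain rfl : k = 0 := by omega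
            exact le_rfl
  | succ n ih =>
    rcases h.eq_or_lt with rfl | h
    · exact le_max_right _ _
    · exact (ih (by omega)).trans (le_max_left _ _)

lemma runMax_nonneg (x : ℕ → ℝ) (n : ℕ) : 0 ≤ runMax x n :=
  (sq_nonneg _).trans (sq_le_runMax x le_rfl)

/-- Hardy's inequality for the running maximum. -/
lemma hardy_runMax (x : ℕ → ℝ) (hx : x 0 = 0) (L : ℕ → ℝ≥0∞) (c : ℕ → ℝ) (n : ℕ)
    (hc : ∀ k < n, 0 < c k) (hL : ∀ k < n, L (k + 1) = L k + ENNReal.ofReal (1 / c k)) :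
    (∑ k ∈ Finset.range n, ENNReal.ofReal (runMax x (k + 1) - runMax x k) * (L (k + 1))⁻¹) +
        ENNReal.ofReal (runMax x n) * (L n)⁻¹ ≤
      4 * ∑ k ∈ Finset.range n, ENNReal.ofReal (c k * (x (k + 1) - x k) ^ 2) := by
  induction n with
  | zero => simp [runMax, hx]
  | succ n ih =>
    specialize ih (fun k hk => hc k (by omega)) (fun k hk => hL k (by omega))
    rw [Finset.sum_range_succ, Finset.sum_range_succ, mul_add]
    refine le_trans ?_ (add_le_add_left ih _)
    rw [add_assoc, add_assoc]
    gcongr 1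
    rw [add_comm (_ * (L n)⁻¹)]
    -- Without a new maximum the potential can only drop, since `L` grows. At a new maximum
    -- `hardy_step` applies to `y = √(runMax x n)` and `z = |x (n + 1)|`: since `y ≥ |x n|`, the
    -- jump `z - y` is at most the true increment.
    rcases le_total (x (n + 1) ^ 2) (runMax x n) with h | h
    · have : runMax x (n + 1) = runMax x n := max_eq_left h
      rw [this, hL n (by omega)]
      simp only [sub_self, ENNReal.ofReal_zero, zero_mul, zero_add]
      refine le_add_left ?_
      gcongr
      exact le_self_add
    · have : runMax x (n + 1) = |x (n + 1)| ^ 2 := by rw [sq_abs]; exact max_eq_right h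
      have hs : √(runMax x n) ^ 2 = runMax x n := Real.sq_sqrt (runMax_nonneg x n)
      have h1 : √(runMax x n) ≤ |x (n + 1)| := Real.sqrt_le_iff.2 ⟨abs_nonneg _, by rwa [sq_abs]⟩
      have h2 : |x n| ≤ √(runMax x n) := Real.abs_le_sqrt (sq_le_runMax x le_rfl)
      have := hardy_step (Real.sqrt_nonneg _) h1 (L n) (hc n (by omega))
      rw [hs, ← hL n (by omega)] at this
      rw [‹runMax x (n + 1) = _›]
      refine this.trans ?_
      have hcn := (hc n (by omega)).le
      gcongr _ * ENNReal.ofReal (_ * ?_) + _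
      rw [sq_le_sq, abs_of_nonneg (sub_nonneg.2 h1)]
      have := abs_sub_abs_le_abs_sub (x (n + 1)) (x n)
      linarith

/-- Hardy's inequality, in terms of the level sets of a sequence. -/
lemma exists_layer (x : ℕ → ℝ) (hx : x 0 = 0) (L : ℕ → ℝ≥0∞) (c : ℕ → ℝ) (n : ℕ)
    (hc : ∀ k < n, 0 < c k) (hL : ∀ k < n, L (k + 1) = L k + ENNReal.ofReal (1 / c k)) :
    ∃ Λ : ℝ → ℝ≥0∞, Measurable Λ ∧
      ∫⁻ t, Λ t ≤ 4 * ∑ k ∈ Finset.range n, ENNReal.ofReal (c k * (x (k + 1) - x k) ^ 2) ∧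
      ∀ t, 0 < t → t ≤ x n ^ 2 → ∃ j < n, (∀ i ≤ j, x i ^ 2 < t) ∧ (L (j + 1))⁻¹ ≤ Λ t := by
  -- `Λ t` is `1 / L (j + 1)` on the heights `t` first reached at time `j + 1`, so its integral is
  -- the sum in `hardy_runMax`.
  refine ⟨fun t => ∑ k ∈ Finset.range n,
    (Set.Ioc (runMax x k) (runMax x (k + 1))).indicator (fun _ => (L (k + 1))⁻¹) t, ?_, ?_, ?_⟩
  · exact Finset.measurable_sum _ fun k _ => measurable_const.indicator measurableSet_Ioc
  · rw [lintegral_finsetSum _ fun k _ => measurable_const.indicator measurableSet_Ioc]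
    refine le_trans ?_ (hardy_runMax x hx L c n hc hL)
    refine le_add_right (Finset.sum_le_sum fun k _ => ?_)
    rw [lintegral_indicator measurableSet_Ioc, setLIntegral_const, Real.volume_Ioc, mul_comm]
  · intro t ht htn
    have hex : ∃ m, t ≤ runMax x m := ⟨n, htn.trans (sq_le_runMax x le_rfl)⟩
    classical
    have hspec := Nat.find_spec hex
    have hle : Nat.find hex ≤ n := Nat.find_le (htn.trans (sq_le_runMax x le_rfl))
    obtain ⟨j, hj⟩ : ∃ j, Nat.find hex = j + 1 := by
      refine Nat.exists_eq_succ_of_ne_zero fun h0 => ?_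
      rw [h0] at hspec
      simp only [runMax, hx] at hspec
      norm_num at hspec
      linarith
    have hlt : runMax x j < t := not_le.1 (Nat.find_min hex (by omega))
    refine ⟨j, by omega, fun i hi => (sq_le_runMax x hi).trans_lt hlt, ?_⟩
    rw [hj] at hspec
    have := Finset.single_le_sum (f := fun k => (Set.Ioc (runMax x k) (runMax x (k + 1))).indicator
      (fun _ => (L (k + 1))⁻¹) t) (fun _ _ => zero_le) (Finset.mem_range.2 (by omega : j < n))
    rwa [Set.indicator_of_mem (show t ∈ Set.Ioc _ _ from ⟨hlt, hspec⟩)] at this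

/-! ### The state space and detailed balance -/

lemma mem_stateSpace_of_mem_Icc {i j k : ℤ} (hi : i ∈ stateSpace M N) (hj : j ∈ stateSpace M N)
    (hik : i ≤ k) (hkj : k ≤ j) : k ∈ stateSpace M N := by
  refine ⟨lt_of_le_of_lt ?_ hi.1, lt_of_le_of_lt ?_ hj.2⟩
  · exact WithTop.coe_le_coe.2 (by omega)
  · exact WithTop.coe_le_coe.2 hkj

lemma zeroExt_of_notMem (f : stateSpace M N → ℝ) {i : ℤ} (h : i ∉ stateSpace M N) :
    zeroExt f i = 0 := by simp [zeroExt, h]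

lemma zeroExt_coe (f : stateSpace M N → ℝ) (i : stateSpace M N) : zeroExt f i = f i := by
  simp [zeroExt]

section weight

variable {a b : ℤ → ℝ} (ha : ∀ i ∈ stateSpace M N, 0 < a i) (hb : ∀ i ∈ stateSpace M N, 0 < b i)
  (θ : stateSpace M N)

include ha hb in
lemma weight_pos {i : ℤ} (hi : i ∈ stateSpace M N) : 0 < weight a b θ i := by
  have ha' := ha _ θ.2
  have hb' := hb _ θ.2
  unfold weight
  split_ifs with h1 h2
  · positivity
  · refine div_pos (Finset.prod_pos fun k hk => hb k ?_) (Finset.prod_pos fun k hk => ha k ?_)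
    · rw [Finset.mem_Ioo] at hk
      exact mem_stateSpace_of_mem_Icc θ.2 hi hk.1.le hk.2.le
    · rw [Finset.mem_Icc] at hk
      exact mem_stateSpace_of_mem_Icc θ.2 hi hk.1 hk.2
  · refine div_pos (Finset.prod_pos fun k hk => ha k ?_) (Finset.prod_pos fun k hk => hb k ?_)
    · rw [Finset.mem_Ioo] at hk
      exact mem_stateSpace_of_mem_Icc hi θ.2 hk.1.le hk.2.le
    · rw [Finset.mem_Icc] at hk
      exact mem_stateSpace_of_mem_Icc hi θ.2 hk.1 hk.2

include ha hb in
-- Detailed balance to the right of `θ`: going from `i - 1` to `i` appends `b (i - 1)` to the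
-- numerator and `a i` to the denominator. The neighbour of `θ` is separate because the weight at
-- `θ` has its own formula.
lemma weight_mul_of_lt {i : ℤ} (hi : i ∈ stateSpace M N) (h : (θ : ℤ) < i) :
    weight a b θ i * a i = weight a b θ (i - 1) * b (i - 1) := by
  have hai := (ha i hi).ne'
  have hC : Finset.Icc (θ : ℤ) i = insert i (Finset.Icc (θ : ℤ) (i - 1)) := by
    ext k; simp only [Finset.mem_Icc, Finset.mem_insert]; omega
  by_cases h1 : i - 1 = θ
  · have hO : Finset.Ioo (θ : ℤ) i = ∅ := by
      ext k; simp only [Finset.mem_Ioo, Finset.notMem_empty, iff_false]; omega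
    have := (ha _ θ.2).ne'
    have := (hb _ θ.2).ne'
    rw [weight, if_neg (by omega), if_pos h, weight, if_pos h1, hO, hC, h1,
      Finset.prod_insert (by simp [h.ne']), Finset.Icc_self, Finset.prod_singleton,
      Finset.prod_empty]
    field_simp
  · have hO : Finset.Ioo (θ : ℤ) i = insert (i - 1) (Finset.Ioo (θ : ℤ) (i - 1)) := by
      ext k; simp only [Finset.mem_Ioo, Finset.mem_insert]; omega
    rw [weight, if_neg (by omega), if_pos h, weight, if_neg h1, if_pos (by omega), hO, hC,
      Finset.prod_insert (by simp), Finset.prod_insert (by simp)]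
    field_simp

include ha hb in
lemma weight_mul_of_gt {i : ℤ} (hi : i ∈ stateSpace M N) (h : i < (θ : ℤ)) :
    weight a b θ i * b i = weight a b θ (i + 1) * a (i + 1) := by
  have hbi := (hb i hi).ne'
  have hC : Finset.Icc i (θ : ℤ) = insert i (Finset.Icc (i + 1) (θ : ℤ)) := by
    ext k; simp only [Finset.mem_Icc, Finset.mem_insert]; omega
  by_cases h1 : i + 1 = θ
  · have hO : Finset.Ioo i (θ : ℤ) = ∅ := by
      ext k; simp only [Finset.mem_Ioo, Finset.notMem_empty, iff_false]; omega
    have := (ha _ θ.2).ne'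
    have := (hb _ θ.2).ne'
    rw [weight, if_neg (by omega), if_neg (by omega), weight, if_pos h1, hO, hC, h1,
      Finset.prod_insert (by simp [h.ne]), Finset.Icc_self, Finset.prod_singleton,
      Finset.prod_empty]
    field_simp
  · have hO : Finset.Ioo i (θ : ℤ) = insert (i + 1) (Finset.Ioo (i + 1) (θ : ℤ)) := by
      ext k; simp only [Finset.mem_Ioo, Finset.mem_insert]; omega
    rw [weight, if_neg (by omega), if_neg (by omega), weight, if_neg h1, if_neg (by omega), hO, hC,
      Finset.prod_insert (by simp), Finset.prod_insert (by simp)]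
    field_simp

end weight

/-! ### The chain as an electrical network -/

/-- The conductance of the edge `{j - 1, j}`. -/
def edgeCond (a b : ℤ → ℝ) (θ : stateSpace M N) (j : ℤ) : ℝ :=
  if j ≤ θ then weight a b θ j * a j else weight a b θ (j - 1) * b (j - 1)

open Classical in
/-- The resistance of the edge `{j - 1, j}`; it is `0` if the edge does not meet the state space. -/
def edgeRes (a b : ℤ → ℝ) (θ : stateSpace M N) (j : ℤ) : ℝ :=
  if j ∈ stateSpace M N ∨ j - 1 ∈ stateSpace M N then 1 / edgeCond a b θ j else 0

/-- The resistance between `-M - 1` and `m`. -/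
def leftRes (a b : ℤ → ℝ) (θ : stateSpace M N) (m : ℤ) : ℝ≥0∞ :=
  ∑' j : Set.Iic m, ENNReal.ofReal (edgeRes a b θ j)

/-- The resistance between `n` and `N + 1`. -/
def rightRes (a b : ℤ → ℝ) (θ : stateSpace M N) (n : ℤ) : ℝ≥0∞ :=
  ∑' j : Set.Ioi n, ENNReal.ofReal (edgeRes a b θ j)

lemma leftRes_add_one (a b : ℤ → ℝ) (θ : stateSpace M N) (m : ℤ) :
    leftRes a b θ (m + 1) = leftRes a b θ m + ENNReal.ofReal (edgeRes a b θ (m + 1)) := by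
  have h : Set.Iic (m + 1) = Set.Iic m ∪ {m + 1} := by
    ext k; simp only [Set.mem_Iic, Set.mem_union, Set.mem_singleton_iff]; omega
  rw [leftRes, h, ENNReal.summable.tsum_union_disjoint
      (f := fun j => ENNReal.ofReal (edgeRes a b θ j)) (by simp) ENNReal.summable,
    tsum_singleton (m + 1) (fun j => ENNReal.ofReal (edgeRes a b θ j)), leftRes]

lemma rightRes_sub_one (a b : ℤ → ℝ) (θ : stateSpace M N) (n : ℤ) :
    rightRes a b θ (n - 1) = rightRes a b θ n + ENNReal.ofReal (edgeRes a b θ n) := by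
  have h : Set.Ioi (n - 1) = Set.Ioi n ∪ {n} := by
    ext k; simp only [Set.mem_Ioi, Set.mem_union, Set.mem_singleton_iff]; omega
  rw [rightRes, h, ENNReal.summable.tsum_union_disjoint
      (f := fun j => ENNReal.ofReal (edgeRes a b θ j)) (by simp) ENNReal.summable,
    tsum_singleton n (fun j => ENNReal.ofReal (edgeRes a b θ j)), rightRes]

section edge

variable {a b : ℤ → ℝ} (ha : ∀ i ∈ stateSpace M N, 0 < a i) (hb : ∀ i ∈ stateSpace M N, 0 < b i)
  (θ : stateSpace M N)

include ha hb in
lemma weight_mul_death {i : ℤ} (hi : i ∈ stateSpace M N) :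
    weight a b θ i * a i = edgeCond a b θ i := by
  unfold edgeCond
  split_ifs with h
  · rfl
  · exact weight_mul_of_lt ha hb θ hi (by omega)

include ha hb in
lemma weight_mul_birth {i : ℤ} (hi : i ∈ stateSpace M N) :
    weight a b θ i * b i = edgeCond a b θ (i + 1) := by
  unfold edgeCond
  split_ifs with h
  · exact weight_mul_of_gt ha hb θ hi (by omega)
  · simp

include ha hb in
lemma edgeCond_pos {j : ℤ} (hj : j ∈ stateSpace M N ∨ j - 1 ∈ stateSpace M N) :
    0 < edgeCond a b θ j := by
  rcases hj with hj | hj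
  · rw [← weight_mul_death ha hb θ hj]
    exact mul_pos (weight_pos ha hb θ hj) (ha j hj)
  · have := weight_mul_birth ha hb θ hj
    rw [sub_add_cancel] at this
    rw [← this]
    exact mul_pos (weight_pos ha hb θ hj) (hb _ hj)

include ha hb in
lemma edgeRes_nonneg (j : ℤ) : 0 ≤ edgeRes a b θ j := by
  unfold edgeRes
  split_ifs with h
  · exact (one_div_pos.2 (edgeCond_pos ha hb θ h)).le
  · exact le_rfl

include ha hb in
-- The two sums together run once over each edge that meets the state space: edges up to `θ` appear
-- through their death term, later ones through their birth term. On all other edges both endpoint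
-- values are `0`, so the value of `edgeCond` there is irrelevant.
lemma dirichletForm_eq (f : stateSpace M N → ℝ) :
    dirichletForm a b θ f =
      ∑' j : ℤ, ENNReal.ofReal (edgeCond a b θ j * (zeroExt f j - zeroExt f (j - 1)) ^ 2) := by
  set φ : ℤ → ℝ≥0∞ := fun j =>
    ENNReal.ofReal (edgeCond a b θ j * (zeroExt f j - zeroExt f (j - 1)) ^ 2) with hφ
  have h1 : (∑' i : Set.Iic θ, ENNReal.ofReal (weight a b θ i * a i *
      (zeroExt f i - zeroExt f ((i : ℤ) - 1)) ^ 2)) =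
      ∑' j : ℤ, (Set.Iic (θ : ℤ)).indicator φ j := by
    have hinj : Function.Injective fun i : Set.Iic θ => ((i : stateSpace M N) : ℤ) :=
      Subtype.val_injective.comp Subtype.val_injective
    rw [← hinj.tsum_eq]
    · refine tsum_congr fun i => ?_
      rw [Set.indicator_of_mem (show ((i : stateSpace M N) : ℤ) ∈ Set.Iic (θ : ℤ) from i.2), hφ,
        weight_mul_death ha hb θ i.1.2]
    · intro j hj
      rw [Function.mem_support, Set.indicator_apply_ne_zero] at hj
      by_cases hjS : j ∈ stateSpace M N
      · exact ⟨⟨⟨j, hjS⟩, hj.1⟩, rfl⟩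
      · have : j - 1 ∉ stateSpace M N := fun h =>
          hjS (mem_stateSpace_of_mem_Icc h θ.2 (by omega) hj.1)
        exact absurd (by simp [hφ, zeroExt_of_notMem, hjS, this]) hj.2
  have h2 : (∑' i : Set.Ici θ, ENNReal.ofReal (weight a b θ i * b i *
      (zeroExt f ((i : ℤ) + 1) - zeroExt f i) ^ 2)) =
      ∑' j : ℤ, ((Set.Iic (θ : ℤ))ᶜ).indicator φ j := by
    have hinj : Function.Injective fun i : Set.Ici θ => ((i : stateSpace M N) : ℤ) + 1 :=
      (add_left_injective 1).comp (Subtype.val_injective.comp Subtype.val_injective)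
    rw [← hinj.tsum_eq]
    · refine tsum_congr fun i => ?_
      have hi : (θ : ℤ) ≤ (i : stateSpace M N) := i.2
      rw [Set.indicator_of_mem (by simp only [Set.mem_compl_iff, Set.mem_Iic]; omega), hφ,
        weight_mul_birth ha hb θ i.1.2]
      simp
    · intro j hj
      rw [Function.mem_support, Set.indicator_apply_ne_zero] at hj
      have hj1 : (θ : ℤ) < j := not_le.1 hj.1
      by_cases hjS : j - 1 ∈ stateSpace M N
      · exact ⟨⟨⟨j - 1, hjS⟩, show (θ : ℤ) ≤ j - 1 by omega⟩, by simp⟩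
      · have : j ∉ stateSpace M N := fun h =>
          hjS (mem_stateSpace_of_mem_Icc θ.2 h (by omega) (by omega))
        exact absurd (by simp [hφ, zeroExt_of_notMem, hjS, this]) hj.2
  rw [dirichletForm, h1, h2, ← ENNReal.tsum_add]
  refine tsum_congr fun j => ?_
  exact congrFun (Set.indicator_self_add_compl (Set.Iic (θ : ℤ)) φ) j

include ha hb in
-- The birth term at `i` belongs to the edge `i + 1`, hence the strict inequality in `rightRes`.
lemma conductance_eq (m n : stateSpace M N) :
    conductance a b θ m n = (leftRes a b θ m)⁻¹ + (rightRes a b θ n)⁻¹ := by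
  rw [conductance, leftRes, rightRes]
  congr 2
  · have hinj : Function.Injective
        fun i : Set.Iic m => (⟨(i : stateSpace M N), i.2⟩ : Set.Iic (m : ℤ)) :=
      fun x y h => Subtype.ext (Subtype.ext (congrArg (fun z => z.1) h))
    rw [← hinj.tsum_eq]
    · refine tsum_congr fun i => ?_
      rw [edgeRes, if_pos (Or.inl i.1.2), weight_mul_death ha hb θ i.1.2]
    · rintro ⟨j, hjm⟩ hj
      have hj' : j ∈ stateSpace M N ∨ j - 1 ∈ stateSpace M N := by
        by_contra h
        simp [edgeRes, h] at hj
      have hjS : j ∈ stateSpace M N := hj'.elim id fun h =>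
        mem_stateSpace_of_mem_Icc h m.2 (by omega) hjm
      exact ⟨⟨⟨j, hjS⟩, hjm⟩, rfl⟩
  · have hinj : Function.Injective fun i : Set.Ici n =>
        (⟨(i : stateSpace M N) + 1, Int.lt_add_one_of_le i.2⟩ : Set.Ioi (n : ℤ)) :=
      fun x y h => Subtype.ext (Subtype.ext (add_left_injective 1 (congrArg (fun z => z.1) h)))
    rw [← hinj.tsum_eq]
    · refine tsum_congr fun i => ?_
      rw [edgeRes, if_pos (Or.inr (by simp)), weight_mul_birth ha hb θ i.1.2]
    · rintro ⟨j, hjn⟩ hj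
      have hjn' : (n : ℤ) < j := hjn
      have hj' : j ∈ stateSpace M N ∨ j - 1 ∈ stateSpace M N := by
        by_contra h
        simp [edgeRes, h] at hj
      have hjS : j - 1 ∈ stateSpace M N := hj'.elim (fun h =>
        mem_stateSpace_of_mem_Icc n.2 h (by omega) (by omega)) id
      exact ⟨⟨⟨j - 1, hjS⟩, show (n : ℤ) ≤ j - 1 by omega⟩, Subtype.ext (by simp)⟩

end edge

lemma lintegral_symMeasure (a b : ℤ → ℝ) (θ : stateSpace M N) (F : stateSpace M N → ℝ≥0∞) :
    ∫⁻ i, F i ∂(symMeasure a b θ) =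
      ∑' i : stateSpace M N, ENNReal.ofReal (weight a b θ i) * F i := by
  rw [symMeasure, lintegral_sum_measure]
  refine tsum_congr fun i => ?_
  rw [lintegral_smul_measure, lintegral_dirac, smul_eq_mul]

/-! ### The upper bound for weighted sums -/

section upper

variable {a b : ℤ → ℝ} (ha : ∀ i ∈ stateSpace M N, 0 < a i) (hb : ∀ i ∈ stateSpace M N, 0 < b i)
  (θ : stateSpace M N)

/-- Layer cake: `h²` is the integral over `t > 0` of the indicator of `t ≤ h²`, and sum and integral
commute by Tonelli. -/
lemma tsum_sq_mul_le_of_layer {ι : Type*} [Countable ι] (h : ι → ℝ) (W : ι → ℝ≥0∞)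
    {Λ : ℝ → ℝ≥0∞} (hΛ : ∀ t, 0 < t → (∃ i, t ≤ h i ^ 2) →
      ∑' i, {i | t ≤ h i ^ 2}.indicator W i ≤ Λ t) :
    ∑' i, ENNReal.ofReal (h i ^ 2) * W i ≤ ∫⁻ t, Λ t := by
  have h1 : ∀ i, ENNReal.ofReal (h i ^ 2) * W i =
      ∫⁻ t, (Set.Ioc 0 (h i ^ 2)).indicator (fun _ => W i) t := fun i => by
    rw [lintegral_indicator measurableSet_Ioc, setLIntegral_const, Real.volume_Ioc, sub_zero,
      mul_comm]
  simp_rw [h1]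
  rw [← lintegral_tsum fun i => (measurable_const.indicator measurableSet_Ioc).aemeasurable]
  refine lintegral_mono fun t => ?_
  by_cases ht : 0 < t ∧ ∃ i, t ≤ h i ^ 2
  · refine le_trans (ENNReal.tsum_le_tsum fun i => ?_) (hΛ t ht.1 ht.2)
    by_cases hi : t ≤ h i ^ 2
    · rw [Set.indicator_of_mem (show i ∈ {i | t ≤ h i ^ 2} from hi)]
      exact Set.indicator_le_self' (fun _ _ => zero_le) _
    · rw [Set.indicator_of_notMem fun h => hi h.2]
      exact zero_le
  · rw [not_and, not_exists] at ht
    refine le_of_eq_of_le ?_ zero_le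
    exact ENNReal.tsum_eq_zero.2 fun i => Set.indicator_of_notMem (fun h => ht h.1 i h.2) _

include ha hb in
-- The capacity bound on intervals is applied to every level set of `h²`. Cutting at a peak lets
-- each side be handled by its own Hardy inequality without counting any edge twice.
lemma tsum_sq_mul_le (C : ℝ≥0∞) (W : stateSpace M N → ℝ≥0∞)
    (hW : ∀ m n : stateSpace M N, m ≤ n →
      ∑' i, (Set.Icc m n).indicator W i ≤ C * conductance a b θ m n)
    (h : stateSpace M N → ℝ) (hh : (Function.support h).Finite) :
    ∑' i, ENNReal.ofReal (h i ^ 2) * W i ≤ C * (4 * dirichletForm a b θ h) := by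
  set T := hh.toFinset with hT
  have hmem : ∀ i, i ∈ T ↔ h i ≠ 0 := fun i => by simp [hT]
  rcases T.eq_empty_or_nonempty with hT0 | hne
  · have h0 : ∀ i, h i = 0 := fun i => by
      by_contra hi
      simpa [hT0] using (hmem i).2 hi
    simp [h0]
  obtain ⟨s, hsT, hs⟩ := T.exists_max_image (fun i => h i ^ 2) hne
  have hs' : ∀ i, h i ^ 2 ≤ h s ^ 2 := fun i => by
    by_cases hi : h i = 0
    · rw [hi]; nlinarith [sq_nonneg (h s)]
    · exact hs i ((hmem i).2 hi)
  set p := T.min' hne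
  set q := T.max' hne
  have hpT : p ∈ T := T.min'_mem hne
  have hqT : q ∈ T := T.max'_mem hne
  have hps : (p : ℤ) ≤ s := T.min'_le s hsT
  have hsq : (s : ℤ) ≤ q := T.le_max' s hsT
  have hFp : zeroExt h (p - 1) = 0 := by
    by_cases hS : (p : ℤ) - 1 ∈ stateSpace M N
    · rw [zeroExt, dif_pos hS]
      by_contra h0
      have : (p : ℤ) ≤ p - 1 := T.min'_le _ ((hmem _).2 h0)
      omega
    · exact zeroExt_of_notMem h hS
  have hFq : zeroExt h (q + 1) = 0 := by
    by_cases hS : (q : ℤ) + 1 ∈ stateSpace M N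
    · rw [zeroExt, dif_pos hS]
      by_contra h0
      have : (q : ℤ) + 1 ≤ q := T.le_max' _ ((hmem _).2 h0)
      omega
    · exact zeroExt_of_notMem h hS
  -- The branches start at `p - 1` and `q + 1`, where the extended `h` vanishes, and reach the peak
  -- `s` after `n` and `n'` steps.
  obtain ⟨n, hn⟩ := Int.eq_ofNat_of_zero_le (show 0 ≤ (s : ℤ) - p + 1 by omega)
  obtain ⟨n', hn'⟩ := Int.eq_ofNat_of_zero_le (show 0 ≤ (q : ℤ) - s + 1 by omega)
  have hmemL : ∀ k < n, (p : ℤ) + k ∈ stateSpace M N := fun k hk =>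
    mem_stateSpace_of_mem_Icc p.2 s.2 (by omega) (by omega)
  have hmemR : ∀ k < n', (q : ℤ) - k ∈ stateSpace M N := fun k hk =>
    mem_stateSpace_of_mem_Icc s.2 q.2 (by omega) (by omega)
  obtain ⟨Λ₁, hm₁, hi₁, hΛ₁⟩ := exists_layer (fun k => zeroExt h (p - 1 + k)) (by simpa using hFp)
    (fun k => leftRes a b θ (p - 1 + k)) (fun k => edgeCond a b θ (p + k)) n
    (fun k hk => edgeCond_pos ha hb θ (Or.inl (hmemL k hk))) (fun k hk => by
      have := leftRes_add_one a b θ (p - 1 + k)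
      rw [show (p : ℤ) - 1 + k + 1 = p + k by ring, edgeRes, if_pos (Or.inl (hmemL k hk))] at this
      simp only [Nat.cast_add, Nat.cast_one]
      rw [← this]
      congr 1
      ring)
  have hR : ∀ k < n', (q : ℤ) + 1 - k - 1 ∈ stateSpace M N := fun k hk => by
    rw [show (q : ℤ) + 1 - k - 1 = q - k by ring]
    exact hmemR k hk
  obtain ⟨Λ₂, hm₂, hi₂, hΛ₂⟩ := exists_layer (fun k => zeroExt h (q + 1 - k)) (by simpa using hFq)
    (fun k => rightRes a b θ (q + 1 - k)) (fun k => edgeCond a b θ (q + 1 - k)) n'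
    (fun k hk => edgeCond_pos ha hb θ (Or.inr (hR k hk))) (fun k hk => by
      have := rightRes_sub_one a b θ (q + 1 - k)
      rw [edgeRes, if_pos (Or.inr (hR k hk))] at this
      simp only [Nat.cast_add, Nat.cast_one]
      rw [← this]
      congr 1
      ring)
  -- The left branch uses the edges `p, …, s` and the right branch the edges `s + 1, …, q + 1`,
  -- which are disjoint.
  have hen : (∑ k ∈ Finset.range n, ENNReal.ofReal (edgeCond a b θ (p + k) *
      (zeroExt h (p - 1 + (k + 1 : ℕ)) - zeroExt h (p - 1 + k)) ^ 2)) +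
      ∑ k ∈ Finset.range n', ENNReal.ofReal (edgeCond a b θ (q + 1 - k) *
      (zeroExt h (q + 1 - (k + 1 : ℕ)) - zeroExt h (q + 1 - k)) ^ 2) ≤ dirichletForm a b θ h := by
    rw [dirichletForm_eq ha hb]
    have hinj : Function.Injective
        (Sum.elim (fun k : Fin n => (p : ℤ) + k) (fun k : Fin n' => (q : ℤ) + 1 - k)) := by
      refine Function.Injective.sumElim (fun k l hkl => ?_) (fun k l hkl => ?_) (fun k l => ?_)
      · omega
      · omega
      · omega
    refine le_of_eq_of_le ?_ (ENNReal.tsum_comp_le_tsum_of_injective hinj _)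
    rw [tsum_fintype, Fintype.sum_sum_type, Finset.sum_range, Finset.sum_range]
    congr 1
    · refine Finset.sum_congr rfl fun k _ => ?_
      simp only [Sum.elim_inl, Nat.cast_add, Nat.cast_one]
      congr 5 <;> ring_nf
    · refine Finset.sum_congr rfl fun k _ => ?_
      simp only [Sum.elim_inr, Nat.cast_add, Nat.cast_one]
      rw [← neg_sub (zeroExt h _), neg_sq]
      congr 5
      ring_nf
  refine (tsum_sq_mul_le_of_layer h W (Λ := fun t => C * (Λ₁ t + Λ₂ t)) ?_).trans ?_
  · rintro t ht ⟨i, hi⟩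
    have hts := hi.trans (hs' i)
    obtain ⟨j, hj, hj1, hj2⟩ := hΛ₁ t ht (by
      rw [show (p : ℤ) - 1 + n = s by omega, zeroExt_coe]
      exact hts)
    obtain ⟨l, hl, hl1, hl2⟩ := hΛ₂ t ht (by
      rw [show (q : ℤ) + 1 - n' = s by omega, zeroExt_coe]
      exact hts)
    rw [show (p : ℤ) - 1 + (j + 1 : ℕ) = p + j by push_cast; ring] at hj2
    rw [show (q : ℤ) + 1 - (l + 1 : ℕ) = q - l by push_cast; ring] at hl2
    -- Before `p + j` and after `q - l` the values of `h²` are below `t`. Both first passages occur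
    -- no later than at `s`, so `p + j ≤ s ≤ q - l`.
    have hsub : {i | t ≤ h i ^ 2} ⊆
        Set.Icc (⟨p + j, hmemL j hj⟩ : stateSpace M N) ⟨q - l, hmemR l hl⟩ := by
      intro i hi
      have hi' : t ≤ h i ^ 2 := hi
      have hiT : i ∈ T := (hmem i).2 fun h0 => by rw [h0] at hi'; norm_num at hi'; linarith
      have hpi : (p : ℤ) ≤ i := T.min'_le i hiT
      have hiq : (i : ℤ) ≤ q := T.le_max' i hiT
      constructor
      · change (p : ℤ) + j ≤ i
        by_contra hlt
        obtain ⟨k, hk⟩ := Int.eq_ofNat_of_zero_le (show 0 ≤ (i : ℤ) - p + 1 by omega)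
        have := hj1 k (by omega)
        rw [show (p : ℤ) - 1 + k = i by omega, zeroExt_coe] at this
        linarith
      · change (i : ℤ) ≤ q - l
        by_contra hlt
        obtain ⟨k, hk⟩ := Int.eq_ofNat_of_zero_le (show 0 ≤ (q : ℤ) - i + 1 by omega)
        have := hl1 k (by omega)
        rw [show (q : ℤ) + 1 - k = i by omega, zeroExt_coe] at this
        linarith
    refine (ENNReal.tsum_le_tsum fun i => Set.indicator_le_indicator_of_subset hsub
      (fun _ => zero_le) i).trans ((hW _ _ ?_).trans ?_)
    · change (p : ℤ) + j ≤ q - l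
      omega
    · rw [conductance_eq ha hb]
      gcongr
  · rw [lintegral_const_mul (f := fun t => Λ₁ t + Λ₂ t) _ (hm₁.add hm₂), lintegral_add_left hm₁]
    gcongr
    refine (add_le_add hi₁ hi₂).trans ?_
    rw [← mul_add]
    gcongr

include ha hb in
-- Young's inequality on each edge, from `h = f - (f - h)`; a factor close to `1` in front of `D(f)`
-- suffices for the limit.
lemma dirichletForm_le_add {δ : ℝ} (hδ : 0 < δ) (f h : stateSpace M N → ℝ) :
    dirichletForm a b θ h ≤ ENNReal.ofReal (1 + δ) * dirichletForm a b θ f +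
      ENNReal.ofReal (1 + 1 / δ) * dirichletForm a b θ (f - h) := by
  simp_rw [dirichletForm_eq ha hb]
  rw [← ENNReal.tsum_mul_left, ← ENNReal.tsum_mul_left, ← ENNReal.tsum_add]
  refine ENNReal.tsum_le_tsum fun j => ?_
  have hsub : ∀ i, zeroExt (f - h) i = zeroExt f i - zeroExt h i := fun i => by
    unfold zeroExt
    split_ifs <;> simp
  by_cases hj : j ∈ stateSpace M N ∨ j - 1 ∈ stateSpace M N
  · have hc := (edgeCond_pos ha hb θ hj).le
    rw [← ENNReal.ofReal_mul (by positivity), ← ENNReal.ofReal_mul (by positivity),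
      ← ENNReal.ofReal_add (by positivity) (by positivity), hsub, hsub]
    refine ENNReal.ofReal_le_ofReal ?_
    generalize zeroExt f j = x, zeroExt f (j - 1) = x', zeroExt h j = y, zeroExt h (j - 1) = y'
    rw [mul_left_comm, mul_left_comm (1 + 1 / δ), ← mul_add]
    refine mul_le_mul_of_nonneg_left ?_ hc
    have : (1 + δ) * (x - x') ^ 2 + (1 + 1 / δ) * (x - y - (x' - y')) ^ 2 - (y - y') ^ 2 =
        (δ * (x - x') + (x - y - (x' - y'))) ^ 2 / δ := by
      field_simp
      ring
    have : 0 ≤ (δ * (x - x') + (x - y - (x' - y'))) ^ 2 / δ := by positivity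
    linarith
  · rw [not_or] at hj
    simp [zeroExt_of_notMem, hj.1, hj.2]

include ha hb in
-- Positive weights turn norm convergence into pointwise convergence, so every finite partial sum
-- passes to the limit.
lemma tsum_sq_mul_le_of_mem_minimalDomain {C : ℝ≥0∞} (hC : C ≠ ∞) (W : stateSpace M N → ℝ≥0∞)
    (hWtop : ∀ i, W i ≠ ∞)
    (hW : ∀ m n : stateSpace M N, m ≤ n →
      ∑' i, (Set.Icc m n).indicator W i ≤ C * conductance a b θ m n)
    {f : stateSpace M N → ℝ} (hf : f ∈ minimalDomain a b θ) :
    ∑' i, ENNReal.ofReal (f i ^ 2) * W i ≤ C * (4 * dirichletForm a b θ f) := by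
  have hδ : ∀ k : ℕ, 0 < 1 / ((k : ℝ) + 1) := fun k => by positivity
  -- With `δ = 1 / (k + 1)`, a tolerance of `δ²` absorbs the factor `1 + 1 / δ` of
  -- `dirichletForm_le_add`, leaving `δ² + δ → 0`.
  choose h hfin hlt using fun k : ℕ =>
    hf (ENNReal.ofReal ((1 / ((k : ℝ) + 1)) ^ 2)) (by have := hδ k; positivity)
  have hδ0 := tendsto_one_div_add_atTop_nhds_zero_nat (𝕜 := ℝ)
  have hD : ∀ k, dirichletForm a b θ (h k) ≤
      ENNReal.ofReal (1 + 1 / ((k : ℝ) + 1)) * dirichletForm a b θ f +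
        ENNReal.ofReal ((1 / ((k : ℝ) + 1)) ^ 2 + 1 / ((k : ℝ) + 1)) := fun k => by
    refine (dirichletForm_le_add ha hb θ (hδ k) f (h k)).trans ?_
    gcongr
    refine (mul_le_mul_right (le_add_self.trans (hlt k).le) _).trans (le_of_eq ?_)
    have := hδ k
    rw [← ENNReal.ofReal_mul (by positivity)]
    congr 1
    field_simp
  have hpt : ∀ i, Filter.Tendsto (fun k => h k i) Filter.atTop (nhds (f i)) := fun i => by
    have hw := weight_pos ha hb θ i.2
    have hle : ∀ k, (f i - h k i) ^ 2 ≤ (1 / ((k : ℝ) + 1)) ^ 2 * (weight a b θ i)⁻¹ := fun k => by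
      have h1 := le_self_add.trans (hlt k).le
      rw [lintegral_symMeasure] at h1
      have h2 := (ENNReal.le_tsum i).trans h1
      have := hδ k
      rw [← ENNReal.ofReal_mul hw.le, ENNReal.ofReal_le_ofReal_iff (by positivity)] at h2
      rw [← div_eq_mul_inv, le_div_iff₀ hw]
      linarith
    have h0 : Filter.Tendsto (fun k => (f i - h k i) ^ 2) Filter.atTop (nhds 0) := by
      refine squeeze_zero (fun k => sq_nonneg _) hle ?_
      simpa using (hδ0.pow 2).mul_const ((weight a b θ i)⁻¹)
    have h1 := (h0.sqrt)
    simp only [Real.sqrt_sq_eq_abs, Real.sqrt_zero] at h1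
    have h2 := (tendsto_zero_iff_abs_tendsto_zero _).2 h1
    simpa using tendsto_const_nhds (x := f i).sub h2
  rw [ENNReal.tsum_eq_iSup_sum]
  refine iSup_le fun s => ?_
  have hlim1 : Filter.Tendsto (fun k => ∑ i ∈ s, ENNReal.ofReal (h k i ^ 2) * W i) Filter.atTop
      (nhds (∑ i ∈ s, ENNReal.ofReal (f i ^ 2) * W i)) :=
    tendsto_finsetSum _ fun i _ => ENNReal.Tendsto.mul_const
      (ENNReal.tendsto_ofReal ((hpt i).pow 2)) (Or.inr (hWtop i))
  have hlim2 : Filter.Tendsto (fun k : ℕ => C * (4 *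
      (ENNReal.ofReal (1 + 1 / ((k : ℝ) + 1)) * dirichletForm a b θ f +
        ENNReal.ofReal ((1 / ((k : ℝ) + 1)) ^ 2 + 1 / ((k : ℝ) + 1))))) Filter.atTop
      (nhds (C * (4 * dirichletForm a b θ f))) := by
    refine ENNReal.Tendsto.const_mul (ENNReal.Tendsto.const_mul ?_ (Or.inr (by simp))) (Or.inr hC)
    have h1 : Filter.Tendsto (fun k : ℕ => ENNReal.ofReal (1 + 1 / ((k : ℝ) + 1))) Filter.atTop
        (nhds 1) := by
      simpa using ENNReal.tendsto_ofReal (hδ0.const_add 1)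
    have h2 : Filter.Tendsto (fun k : ℕ => ENNReal.ofReal
        ((1 / ((k : ℝ) + 1)) ^ 2 + 1 / ((k : ℝ) + 1))) Filter.atTop (nhds 0) := by
      simpa using ENNReal.tendsto_ofReal ((hδ0.pow 2).add hδ0)
    simpa using (ENNReal.Tendsto.mul_const h1 (b := dirichletForm a b θ f)
      (Or.inl one_ne_zero)).add h2
  refine le_of_tendsto_of_tendsto' hlim1 hlim2 fun k => ?_
  refine (ENNReal.sum_le_tsum s).trans ((tsum_sq_mul_le ha hb θ C W hW (h k) (hfin k)).trans ?_)
  gcongr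
  exact hD k

end upper

/-! ### Test functions and the lower bound -/

lemma mem_minimalDomain_of_finite (a b : ℤ → ℝ) (θ : stateSpace M N) {f : stateSpace M N → ℝ}
    (hf : (Function.support f).Finite) : f ∈ minimalDomain a b θ := fun ε hε =>
  ⟨f, hf, by simpa [dirichletForm, zeroExt] using hε⟩

lemma tendsto_leftRes (a b : ℤ → ℝ) (θ : stateSpace M N) (m : ℤ) :
    Filter.Tendsto (fun k : ℕ => ∑ j ∈ Finset.Ioc (m - k) m, ENNReal.ofReal (edgeRes a b θ j))
      Filter.atTop (nhds (leftRes a b θ m)) := by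
  have h1 : leftRes a b θ m = ∑' k : ℕ, ENNReal.ofReal (edgeRes a b θ (m - k)) := by
    have hbij : Function.Bijective fun k : ℕ => (⟨m - k, by simp⟩ : Set.Iic m) := by
      refine ⟨fun k l h => ?_, fun ⟨j, hj⟩ => ⟨(m - j).toNat, Subtype.ext ?_⟩⟩
      · have : m - (k : ℤ) = m - l := congrArg (fun z => z.1) h
        omega
      · have : j ≤ m := hj
        simp only
        omega
    rw [leftRes, ← (Equiv.ofBijective _ hbij).tsum_eq]
    rfl
  have h2 : ∀ k : ℕ, ∑ j ∈ Finset.Ioc (m - k) m, ENNReal.ofReal (edgeRes a b θ j) =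
      ∑ i ∈ Finset.range k, ENNReal.ofReal (edgeRes a b θ (m - i)) := fun k => by
    refine Finset.sum_nbij' (fun j => (m - j).toNat) (fun i => m - i) ?_ ?_ ?_ ?_ ?_
    · intro j hj; rw [Finset.mem_Ioc] at hj; rw [Finset.mem_range]; omega
    · intro j hj; rw [Finset.mem_range] at hj; rw [Finset.mem_Ioc]; omega
    · intro j hj; rw [Finset.mem_Ioc] at hj; omega
    · intro j hj; omega
    · intro j hj; rw [Finset.mem_Ioc] at hj; congr 2; omega
  simp_rw [h1, h2]
  exact ENNReal.tendsto_nat_tsum _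

lemma tendsto_rightRes (a b : ℤ → ℝ) (θ : stateSpace M N) (n : ℤ) :
    Filter.Tendsto (fun k : ℕ => ∑ j ∈ Finset.Ioc n (n + k), ENNReal.ofReal (edgeRes a b θ j))
      Filter.atTop (nhds (rightRes a b θ n)) := by
  have h1 : rightRes a b θ n = ∑' k : ℕ, ENNReal.ofReal (edgeRes a b θ (n + 1 + k)) := by
    have hbij : Function.Bijective
        fun k : ℕ => (⟨n + 1 + k, by rw [Set.mem_Ioi]; omega⟩ : Set.Ioi n) := by
      refine ⟨fun k l h => ?_, fun ⟨j, hj⟩ => ⟨(j - (n + 1)).toNat, Subtype.ext ?_⟩⟩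
      · have : n + 1 + (k : ℤ) = n + 1 + l := congrArg (fun z => z.1) h
        omega
      · have : n < j := hj
        simp only
        omega
    rw [rightRes, ← (Equiv.ofBijective _ hbij).tsum_eq]
    rfl
  have h2 : ∀ k : ℕ, ∑ j ∈ Finset.Ioc n (n + k), ENNReal.ofReal (edgeRes a b θ j) =
      ∑ i ∈ Finset.range k, ENNReal.ofReal (edgeRes a b θ (n + 1 + i)) := fun k => by
    refine Finset.sum_nbij' (fun j => (j - (n + 1)).toNat) (fun i => n + 1 + i) ?_ ?_ ?_ ?_ ?_
    · intro j hj; rw [Finset.mem_Ioc] at hj; rw [Finset.mem_range]; omega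
    · intro j hj; rw [Finset.mem_range] at hj; rw [Finset.mem_Ioc]; omega
    · intro j hj; rw [Finset.mem_Ioc] at hj; omega
    · intro j hj; omega
    · intro j hj; rw [Finset.mem_Ioc] at hj; congr 2; omega
  simp_rw [h1, h2]
  exact ENNReal.tendsto_nat_tsum _

section lower

variable {a b : ℤ → ℝ} (ha : ∀ i ∈ stateSpace M N, 0 < a i) (hb : ∀ i ∈ stateSpace M N, 0 < b i)
  (θ : stateSpace M N)

include ha hb in
-- The edges `m` and `n + 1` next to the interval already have positive resistance.
lemma conductance_ne_top (m n : stateSpace M N) : conductance a b θ m n ≠ ∞ := by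
  have h1 : 0 < edgeRes a b θ m := by
    rw [edgeRes, if_pos (Or.inl m.2)]
    exact one_div_pos.2 (edgeCond_pos ha hb θ (Or.inl m.2))
  have h2 : 0 < edgeRes a b θ (n + 1) := by
    have : (n : ℤ) + 1 - 1 ∈ stateSpace M N := by simp
    rw [edgeRes, if_pos (Or.inr this)]
    exact one_div_pos.2 (edgeCond_pos ha hb θ (Or.inr this))
  have h3 := leftRes_add_one a b θ (m - 1)
  have h4 := rightRes_sub_one a b θ (n + 1)
  rw [sub_add_cancel] at h3
  rw [add_sub_cancel_right] at h4
  rw [conductance_eq ha hb, ENNReal.add_ne_top, ENNReal.inv_ne_top, ENNReal.inv_ne_top, h3, h4]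
  constructor <;> simp [h1, h2]

include ha hb in
-- The equilibrium potential of `[m, n]` when the network is grounded `k` edges away on each side.
-- Truncation gives finite support, and `k ≥ 1` keeps both total resistances positive.
lemma exists_testFunction {m n : stateSpace M N} (hmn : m ≤ n) {k : ℕ} (hk : 1 ≤ k) :
    ∃ f : stateSpace M N → ℝ, (Function.support f).Finite ∧ (∀ i ∈ Set.Icc m n, f i = 1) ∧
      dirichletForm a b θ f =
        (∑ j ∈ Finset.Ioc ((m : ℤ) - k) m, ENNReal.ofReal (edgeRes a b θ j))⁻¹ +
        (∑ j ∈ Finset.Ioc (n : ℤ) (n + k), ENNReal.ofReal (edgeRes a b θ j))⁻¹ := by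
  have hmn' : (m : ℤ) ≤ n := hmn
  set r := edgeRes a b θ with hr
  have hr0 : ∀ j, 0 ≤ r j := edgeRes_nonneg ha hb θ
  have hrpos : ∀ j, (j ∈ stateSpace M N ∨ j - 1 ∈ stateSpace M N) → 0 < r j := fun j hj => by
    rw [hr, edgeRes, if_pos hj]
    exact one_div_pos.2 (edgeCond_pos ha hb θ hj)
  have hrz : ∀ j, ¬ (j ∈ stateSpace M N ∨ j - 1 ∈ stateSpace M N) → r j = 0 := fun j hj => by
    rw [hr, edgeRes, if_neg hj]
  have hcr : ∀ j (t : ℝ), edgeCond a b θ j * (r j / t) ^ 2 = r j / t ^ 2 := fun j t => by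
    by_cases hj : j ∈ stateSpace M N ∨ j - 1 ∈ stateSpace M N
    · have := (edgeCond_pos ha hb θ hj).ne'
      rw [hr, edgeRes, if_pos hj, div_pow]
      field_simp
    · simp [hrz j hj]
  set l : ℝ := ∑ j ∈ Finset.Ioc ((m : ℤ) - k) m, r j with hl
  set R : ℝ := ∑ j ∈ Finset.Ioc (n : ℤ) (n + k), r j with hR
  have hlpos : 0 < l := by
    refine Finset.sum_pos' (fun j _ => hr0 j) ⟨m, ?_, hrpos _ (Or.inl m.2)⟩
    rw [Finset.mem_Ioc]; omega
  have hRpos : 0 < R := by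
    refine Finset.sum_pos' (fun j _ => hr0 j) ⟨n + 1, ?_, hrpos _ (Or.inr (by simp))⟩
    rw [Finset.mem_Ioc]; omega
  -- A product of two ramps, linear in resistance. The left ramp is `1` from `m` on and the right
  -- one up to `n`, so at each point at least one factor is `1`.
  set G : ℤ → ℝ := fun i => (∑ j ∈ Finset.Ioc ((m : ℤ) - k) (min i m), r j) / l *
    ((∑ j ∈ Finset.Ioc (max i n) (n + k), r j) / R) with hG
  -- Edges missing the state space have resistance `0`, so the ramps vanish outside it and the
  -- Dirichlet boundary condition is automatic.
  have hGz : ∀ i, i ∉ stateSpace M N → G i = 0 := fun i hi => by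
    rcases lt_or_ge i m with him | him
    · rw [hG]
      simp only
      rw [Finset.sum_eq_zero, zero_div, zero_mul]
      intro j hj
      rw [Finset.mem_Ioc] at hj
      refine hrz j (not_or.2 ⟨fun h => hi ?_, fun h => hi ?_⟩) <;>
        exact mem_stateSpace_of_mem_Icc h m.2 (by omega) (by omega)
    · have hni : (n : ℤ) < i := by
        by_contra h
        exact hi (mem_stateSpace_of_mem_Icc m.2 n.2 him (by omega))
      rw [hG]
      simp only
      rw [Finset.sum_eq_zero (s := Finset.Ioc (max i n) (n + k)), zero_div, mul_zero]
      intro j hj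
      rw [Finset.mem_Ioc] at hj
      refine hrz j (not_or.2 ⟨fun h => hi ?_, fun h => hi ?_⟩) <;>
        exact mem_stateSpace_of_mem_Icc n.2 h (by omega) (by omega)
  have hl1 : ∀ i : ℤ, m ≤ i → (∑ j ∈ Finset.Ioc ((m : ℤ) - k) (min i m), r j) / l = 1 :=
    fun i hi => by rw [min_eq_right hi, ← hl, div_self hlpos.ne']
  have hR1 : ∀ i : ℤ, i ≤ n → (∑ j ∈ Finset.Ioc (max i n) (n + k), r j) / R = 1 :=
    fun i hi => by rw [max_eq_right hi, ← hR, div_self hRpos.ne']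
  have hl0 : ∀ i : ℤ, i ≤ m - k → ∑ j ∈ Finset.Ioc ((m : ℤ) - k) (min i m), r j = 0 :=
    fun i hi => by rw [Finset.Ioc_eq_empty (by omega), Finset.sum_empty]
  have hR0 : ∀ i : ℤ, (n : ℤ) + k ≤ i → ∑ j ∈ Finset.Ioc (max i n) (n + k), r j = 0 :=
    fun i hi => by rw [Finset.Ioc_eq_empty (by omega), Finset.sum_empty]
  have hdl : ∀ j ∈ Finset.Ioc ((m : ℤ) - k) m, G j - G (j - 1) = r j / l := fun j hj => by
    rw [Finset.mem_Ioc] at hj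
    have : Finset.Ioc ((m : ℤ) - k) j = insert j (Finset.Ioc ((m : ℤ) - k) (j - 1)) := by
      ext i; simp only [Finset.mem_Ioc, Finset.mem_insert]; omega
    simp only [hG]
    rw [hR1 j (by omega), hR1 (j - 1) (by omega), min_eq_left hj.2, min_eq_left (by omega), this,
      Finset.sum_insert (by simp)]
    ring
  have hdR : ∀ j ∈ Finset.Ioc (n : ℤ) (n + k), G j - G (j - 1) = -(r j / R) := fun j hj => by
    rw [Finset.mem_Ioc] at hj
    have : Finset.Ioc (j - 1) ((n : ℤ) + k) = insert j (Finset.Ioc j ((n : ℤ) + k)) := by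
      ext i; simp only [Finset.mem_Ioc, Finset.mem_insert]; omega
    simp only [hG]
    rw [hl1 j (by omega), hl1 (j - 1) (by omega), max_eq_left hj.1.le, max_eq_left (by omega), this,
      Finset.sum_insert (by simp)]
    ring
  have hd0 : ∀ j, j ∉ Finset.Ioc ((m : ℤ) - k) m ∪ Finset.Ioc (n : ℤ) (n + k) →
      G j - G (j - 1) = 0 := fun j hj => by
    simp only [Finset.mem_union, Finset.mem_Ioc] at hj
    simp only [hG]
    by_cases h1 : j ≤ m - k
    · rw [hl0 j h1, hl0 (j - 1) (by omega)]; simp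
    by_cases h2 : j ≤ n
    · rw [hl1 j (by omega), hl1 (j - 1) (by omega), hR1 j (by omega), hR1 (j - 1) (by omega)]
      simp
    · rw [hR0 j (by omega), hR0 (j - 1) (by omega)]; simp
  refine ⟨fun i => G i, ?_, ?_, ?_⟩
  · refine ((Set.finite_Icc ((m : ℤ) - k) (n + k)).preimage
      Subtype.val_injective.injOn).subset fun i hi => ?_
    by_contra h
    refine hi ?_
    rw [Set.mem_preimage, Set.mem_Icc, not_and_or] at h
    simp only [hG]
    rcases h with h | h
    · rw [hl0 i (by omega)]; simp
    · rw [hR0 i (by omega)]; simp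
  · intro i hi
    simp only [hG]
    rw [hl1 i hi.1, hR1 i hi.2, one_mul]
  · have hzG : ∀ i, zeroExt (fun i : stateSpace M N => G i) i = G i := fun i => by
      by_cases hi : i ∈ stateSpace M N
      · rw [zeroExt, dif_pos hi]
      · rw [zeroExt_of_notMem _ hi, hGz i hi]
    have hsum : ∀ (s : Finset ℤ) (t : ℝ), t = ∑ j ∈ s, r j → 0 < t →
        ∑ j ∈ s, ENNReal.ofReal (r j / t ^ 2) = (∑ j ∈ s, ENNReal.ofReal (r j))⁻¹ := by
      intro s t hst ht
      rw [← ENNReal.ofReal_sum_of_nonneg fun j _ => hr0 j, ← hst,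
        ← ENNReal.ofReal_inv_of_pos ht,
        ← ENNReal.ofReal_sum_of_nonneg fun j _ => div_nonneg (hr0 j) (sq_nonneg t),
        ← Finset.sum_div, ← hst]
      congr 1
      field_simp
    rw [dirichletForm_eq ha hb, tsum_eq_sum (s := Finset.Ioc ((m : ℤ) - k) m ∪
      Finset.Ioc (n : ℤ) (n + k)), Finset.sum_union, ← hsum _ l hl hlpos, ← hsum _ R hR hRpos]
    · congr 1
      · refine Finset.sum_congr rfl fun j hj => ?_
        rw [hzG, hzG, hdl j hj, hcr]
      · refine Finset.sum_congr rfl fun j hj => ?_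
        rw [hzG, hzG, hdR j hj, neg_sq, hcr]
    · rw [Finset.disjoint_left]
      intro j hj hj'
      rw [Finset.mem_Ioc] at hj hj'
      omega
    · intro j hj
      rw [hzG, hzG, hd0 j hj]
      simp

include ha hb in
/-- The lower bound for a constant `A` in `Φ(f²) ≤ A D(f)`, on intervals. -/
lemma le_mul_conductance {Φ : (stateSpace M N → ℝ) → ℝ≥0∞} {A : ℝ≥0∞}
    (hA : ∀ f ∈ minimalDomain a b θ, Φ (fun i => f i ^ 2) ≤ A * dirichletForm a b θ f)
    (hA' : A ≠ ∞) {m n : stateSpace M N} (hmn : m ≤ n) {c : ℝ≥0∞}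
    (hΦ : ∀ f : stateSpace M N → ℝ, (∀ i ∈ Set.Icc m n, f i = 1) → c ≤ Φ (fun i => f i ^ 2)) :
    c ≤ A * conductance a b θ m n := by
  rw [conductance_eq ha hb]
  refine ge_of_tendsto (ENNReal.Tendsto.const_mul
    ((tendsto_inv_iff.2 (tendsto_leftRes a b θ m)).add
      (tendsto_inv_iff.2 (tendsto_rightRes a b θ n))) (Or.inr hA')) ?_
  filter_upwards [Filter.eventually_ge_atTop 1] with k hk
  obtain ⟨f, hfin, h1, hD⟩ := exists_testFunction ha hb θ hmn hk
  rw [← hD]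
  exact (hΦ f h1).trans (hA f (mem_minimalDomain_of_finite a b θ hfin))

end lower

/-! ### The general function space -/

lemma FunctionSpace.extNorm_mono {X : Type*} [TopologicalSpace X] [MeasurableSpace X]
    {μ : Measure X} (B : FunctionSpace X μ) {f h : X → ℝ} (hfh : ∀ x, |f x| ≤ |h x|) :
    B.extNorm f ≤ B.extNorm h := by
  refine iSup₂_mono fun g _ => lintegral_mono fun x => ?_
  gcongr
  exact enorm_le_iff_norm_le.2 (hfh x)

section general

variable {a b : ℤ → ℝ} (ha : ∀ i ∈ stateSpace M N, 0 < a i) (hb : ∀ i ∈ stateSpace M N, 0 < b i)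
  (θ : stateSpace M N) (B : FunctionSpace (stateSpace M N) (symMeasure a b θ))

include ha hb in
-- Where local positivity enters. If the norm were `0` while both resistances are infinite, the
-- product `0 * ∞ = 0` would force the isoperimetric constant to be `∞`.
lemma extNorm_indicator_ne_zero (hB : B.HasLocallyPositive) {m n : stateSpace M N} (hmn : m ≤ n) :
    B.extNorm ((Set.Icc m n).indicator fun _ => (1 : ℝ)) ≠ 0 := by
  obtain ⟨g, hg, hpos⟩ := hB
  obtain ⟨c, hc, hcg⟩ := hpos {m} isCompact_singleton
  have hgm : 0 < g m := hc.trans_le (hcg m rfl)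
  refine (lt_of_lt_of_le ?_ (le_iSup₂ (f := fun g (_ : g ∈ B.dual) => _) g hg)).ne'
  rw [lintegral_symMeasure]
  refine lt_of_lt_of_le ?_ (ENNReal.le_tsum m)
  rw [Set.indicator_of_mem (Set.left_mem_Icc.2 hmn)]
  have := weight_pos ha hb θ m.2
  simp only [enorm_one, one_mul]
  exact ENNReal.mul_pos (by simpa using this) (by simpa using hgm.ne')

include ha hb in
lemma extNorm_indicator_le (hiso : isoConst a b θ B ≠ ∞) {m n : stateSpace M N} (hmn : m ≤ n) :
    B.extNorm ((Set.Icc m n).indicator fun _ => (1 : ℝ)) ≤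
      isoConst a b θ B * conductance a b θ m n := by
  have hc := conductance_ne_top ha hb θ m n
  rw [isoConst] at hiso ⊢
  set I := ⨅ (m : stateSpace M N) (n : stateSpace M N) (_ : m ≤ n),
    conductance a b θ m n * (B.extNorm ((Set.Icc m n).indicator fun _ => (1 : ℝ)))⁻¹
  have hI : I ≤ conductance a b θ m n *
      (B.extNorm ((Set.Icc m n).indicator fun _ => (1 : ℝ)))⁻¹ :=
    (iInf_le _ m).trans ((iInf_le _ n).trans (iInf_le _ hmn))
  set K := B.extNorm ((Set.Icc m n).indicator fun _ => (1 : ℝ))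
  rcases eq_or_ne K 0 with hK | hK
  · rw [hK]; exact zero_le
  have hI0 : I ≠ 0 := by simpa using hiso
  have hIt : I ≠ ∞ := ne_top_of_le_ne_top (ENNReal.mul_ne_top hc (by simpa using hK)) hI
  have hKt : K ≠ ∞ := fun h => by
    rw [h, ENNReal.inv_top, mul_zero] at hI
    exact hI0 (le_zero_iff.1 hI)
  have h1 : I * K ≤ conductance a b θ m n := by
    refine (mul_le_mul_left hI K).trans (le_of_eq ?_)
    rw [mul_assoc, ENNReal.inv_mul_cancel hK hKt, mul_one]
  calc K = I⁻¹ * (I * K) := by rw [← mul_assoc, ENNReal.inv_mul_cancel hI0 hIt, one_mul]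
    _ ≤ _ := by gcongr

include ha hb in
theorem isoConst_le_optimalConst (hB : B.HasLocallyPositive) :
    isoConst a b θ B ≤ optimalConst a b θ B.extNorm := by
  refine le_sInf fun A hA => ?_
  rcases eq_or_ne A ∞ with rfl | hAt
  · exact le_top
  rw [isoConst, ENNReal.inv_le_iff_inv_le]
  refine le_iInf fun m => le_iInf fun n => le_iInf fun hmn => ?_
  have hK0 := extNorm_indicator_ne_zero ha hb θ B hB hmn
  have hK := le_mul_conductance ha hb θ hA hAt hmn
    (c := B.extNorm ((Set.Icc m n).indicator fun _ => (1 : ℝ))) fun f hf => by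
      refine B.extNorm_mono fun i => ?_
      by_cases hi : i ∈ Set.Icc m n
      · rw [Set.indicator_of_mem hi, hf i hi, one_pow]
      · rw [Set.indicator_of_notMem hi, abs_zero]
        exact abs_nonneg _
  set K := B.extNorm ((Set.Icc m n).indicator fun _ => (1 : ℝ))
  have hKt : K ≠ ∞ := ne_top_of_le_ne_top
    (ENNReal.mul_ne_top hAt (conductance_ne_top ha hb θ m n)) hK
  have hA0 : A ≠ 0 := fun h => hK0 (by simpa [h] using hK)
  calc A⁻¹ = A⁻¹ * (K * K⁻¹) := by rw [ENNReal.mul_inv_cancel hK0 hKt, mul_one]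
    _ ≤ A⁻¹ * (A * conductance a b θ m n * K⁻¹) := by gcongr
    _ = _ := by rw [← mul_assoc, ← mul_assoc, ENNReal.inv_mul_cancel hA0 hAt, one_mul]

include ha hb in
theorem optimalConst_le_isoConst :
    optimalConst a b θ B.extNorm ≤ 4 * isoConst a b θ B := by
  rcases eq_or_ne (isoConst a b θ B) ∞ with hiso | hiso
  · rw [hiso, ENNReal.mul_top (by norm_num)]
    exact le_top
  -- The supremum over `𝒢` is taken last: each fixed `g` gives the weights `μ g`, whose mass on `[m,
  -- n]` is at most the norm of the indicator.
  refine sInf_le fun f hf => iSup₂_le fun g hg => ?_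
  rw [lintegral_symMeasure, mul_comm 4, mul_assoc]
  refine le_of_eq_of_le (tsum_congr fun i => ?_)
    (tsum_sq_mul_le_of_mem_minimalDomain ha hb θ hiso
      (fun i => ENNReal.ofReal (weight a b θ i) * g i)
      (fun i => ENNReal.mul_ne_top ENNReal.ofReal_ne_top ENNReal.coe_ne_top) ?_ hf)
  · rw [Real.enorm_of_nonneg (sq_nonneg _), mul_left_comm]
  · intro m n hmn
    refine le_trans ?_ (extNorm_indicator_le ha hb θ B hiso hmn)
    refine le_of_eq_of_le ?_ (le_iSup₂ (f := fun g (_ : g ∈ B.dual) => _) g hg)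
    rw [lintegral_symMeasure]
    refine tsum_congr fun i => ?_
    by_cases hi : i ∈ Set.Icc m n
    · simp [Set.indicator_of_mem hi]
    · simp [Set.indicator_of_notMem hi]

end general

/-! ### The spaces `L^q(μ)` -/

section Lp

variable {a b : ℤ → ℝ} (ha : ∀ i ∈ stateSpace M N, 0 < a i) (hb : ∀ i ∈ stateSpace M N, 0 < b i)
  (θ : stateSpace M N)

lemma symMeasure_Icc (m n : stateSpace M N) :
    symMeasure a b θ (Set.Icc m n) =
      ∑ j ∈ Finset.Icc (m : ℤ) (n : ℤ), ENNReal.ofReal (weight a b θ j) := by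
  rw [← lintegral_indicator_one (MeasurableSet.of_discrete), lintegral_symMeasure]
  have h : ∀ i : stateSpace M N,
      ENNReal.ofReal (weight a b θ i) * (Set.Icc m n).indicator 1 i =
        (Finset.Icc (m : ℤ) n : Set ℤ).indicator (fun j => ENNReal.ofReal (weight a b θ j)) i := by
    intro i
    by_cases hi : i ∈ Set.Icc m n
    · have : (i : ℤ) ∈ (Finset.Icc (m : ℤ) n : Set ℤ) := by
        rw [Finset.coe_Icc]; exact ⟨hi.1, hi.2⟩
      rw [Set.indicator_of_mem hi, Set.indicator_of_mem this, Pi.one_apply, mul_one]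
    · have : (i : ℤ) ∉ (Finset.Icc (m : ℤ) n : Set ℤ) := by
        rw [Finset.coe_Icc]; exact fun h => hi ⟨h.1, h.2⟩
      rw [Set.indicator_of_notMem hi, Set.indicator_of_notMem this, mul_zero]
  simp_rw [h]
  have hsupp : ∀ j : ℤ, j ∉ Finset.Icc (m : ℤ) n → (Finset.Icc (m : ℤ) n : Set ℤ).indicator
      (fun j => ENNReal.ofReal (weight a b θ j)) j = 0 := fun j hj =>
    Set.indicator_of_notMem hj _
  rw [Subtype.val_injective.tsum_eq (f := fun j : ℤ => (Finset.Icc (m : ℤ) n : Set ℤ).indicator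
    (fun j => ENNReal.ofReal (weight a b θ j)) j), tsum_eq_sum hsupp]
  · exact Finset.sum_congr rfl fun j hj => Set.indicator_of_mem hj _
  · intro j hj
    have hj' := Finset.mem_Icc.1 (not_imp_comm.1 (hsupp j) hj)
    exact ⟨⟨j, mem_stateSpace_of_mem_Icc m.2 n.2 hj'.1 hj'.2⟩, rfl⟩

lemma isoConst_eq_sobolevIsoConst {p : ℝ} (hp : 2 ≤ p)
    (B : FunctionSpace (stateSpace M N) (symMeasure a b θ))
    (hB : B.IsLp (ENNReal.ofReal (p / 2))) : isoConst a b θ B = sobolevIsoConst a b θ p := by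
  have hext : ∀ m n : stateSpace M N, B.extNorm ((Set.Icc m n).indicator fun _ => (1 : ℝ)) =
      (∑ j ∈ Finset.Icc (m : ℤ) (n : ℤ), ENNReal.ofReal (weight a b θ j)) ^ (2 / p) := by
    intro m n
    have h1 : eLpNorm ((Set.Icc m n).indicator fun _ => (1 : ℝ)) (ENNReal.ofReal (p / 2))
        (symMeasure a b θ) =
        (∑ j ∈ Finset.Icc (m : ℤ) (n : ℤ), ENNReal.ofReal (weight a b θ j)) ^ (2 / p) := by
      rw [eLpNorm_indicator_const MeasurableSet.of_discrete (by simp; linarith)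
        ENNReal.ofReal_ne_top, enorm_one, one_mul, symMeasure_Icc,
        ENNReal.toReal_ofReal (by positivity), one_div_div]
    have hmem : ((Set.Icc m n).indicator fun _ => (1 : ℝ)) ∈ B.carrier := by
      refine (hB.1 _).2 ⟨Measurable.of_discrete, ?_⟩
      rw [h1]
      exact ENNReal.rpow_lt_top_of_nonneg (by positivity) (by simp)
    rw [← h1, ← hB.2 ⟨_, hmem⟩, B.nrm_eq]
    rfl
  simp_rw [isoConst, sobolevIsoConst, hext, ENNReal.rpow_neg]

end Lp

/-- Duality for finite sequences. -/
lemma exists_dual_finset {ι : Type*} (s : Finset ι) {q : ℝ} (hq : 1 ≤ q) (φ : ι → ℝ≥0) :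
    ∃ γ : ι → ℝ≥0, (∀ ψ : ι → ℝ≥0, ∑ i ∈ s, ψ i * γ i ≤ (∑ i ∈ s, ψ i ^ q) ^ (1 / q)) ∧
      ∑ i ∈ s, φ i * γ i = (∑ i ∈ s, φ i ^ q) ^ (1 / q) := by
  -- The exponent `q = 1` has no finite conjugate; there `γ = 1` is dual. For `q > 1` the equality
  -- case of Hölder's inequality provides `γ`.
  rcases hq.eq_or_lt with rfl | hq
  · exact ⟨fun _ => 1, fun ψ => by simp, by simp⟩
  · have hpq := Real.HolderConjugate.conjExponent hq
    obtain ⟨γ, hγ, hγ'⟩ := (NNReal.isGreatest_Lp s φ hpq).1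
    exact ⟨γ, fun ψ => (NNReal.isGreatest_Lp s ψ hpq).2 ⟨γ, hγ, rfl⟩, hγ'⟩

section Lp

variable {a b : ℤ → ℝ} (ha : ∀ i ∈ stateSpace M N, 0 < a i) (hb : ∀ i ∈ stateSpace M N, 0 < b i)
  (θ : stateSpace M N)

/-- The terms of the sum `∑ μ_i |f_i|^q`, to the power `1 / q`. -/
def lpTerm (a b : ℤ → ℝ) (θ : stateSpace M N) (q : ℝ) (f : stateSpace M N → ℝ)
    (i : stateSpace M N) : ℝ≥0 :=
  ‖f i‖₊ * (weight a b θ i).toNNReal ^ (1 / q)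

/-- The density whose pairing with `f` is the pairing of `lpTerm f` with `γ`. -/
def lpDensity (a b : ℤ → ℝ) (θ : stateSpace M N) (q : ℝ) (γ : stateSpace M N → ℝ≥0)
    (i : stateSpace M N) : ℝ≥0 :=
  γ i * ((weight a b θ i).toNNReal ^ (1 / q) / (weight a b θ i).toNNReal)

lemma eLpNorm_eq_tsum_lpTerm {q : ℝ} (hq : 1 ≤ q) (f : stateSpace M N → ℝ) :
    eLpNorm f (ENNReal.ofReal q) (symMeasure a b θ) =
      (∑' i, (lpTerm a b θ q f i : ℝ≥0∞) ^ q) ^ (1 / q) := by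
  rw [eLpNorm_eq_lintegral_rpow_enorm_toReal (by simp; linarith) ENNReal.ofReal_ne_top,
    ENNReal.toReal_ofReal (by linarith), lintegral_symMeasure]
  congr 1
  refine tsum_congr fun i => ?_
  rw [lpTerm, ENNReal.coe_mul, ENNReal.mul_rpow_of_nonneg _ _ (by linarith),
    ENNReal.coe_rpow_of_nonneg _ (by positivity), ← ENNReal.rpow_mul,
    one_div_mul_cancel (by linarith), ENNReal.rpow_one, mul_comm]
  rfl

include ha hb in
-- Spreading `μ` as `μ^{1/q} · μ^{1 - 1/q}` reduces weighted duality to unweighted sequences.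
lemma lintegral_mul_lpDensity (q : ℝ) (f : stateSpace M N → ℝ) (γ : stateSpace M N → ℝ≥0) :
    ∫⁻ i, ‖f i‖ₑ * lpDensity a b θ q γ i ∂(symMeasure a b θ) =
      ∑' i, (lpTerm a b θ q f i * γ i : ℝ≥0∞) := by
  rw [lintegral_symMeasure]
  refine tsum_congr fun i => ?_
  have hw : (weight a b θ i).toNNReal ≠ 0 := (Real.toNNReal_pos.2 (weight_pos ha hb θ i.2)).ne'
  change ((weight a b θ i).toNNReal : ℝ≥0∞) * (((‖f i‖₊ : ℝ≥0) : ℝ≥0∞) * _) = _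
  rw [← ENNReal.coe_mul, ← ENNReal.coe_mul, ← ENNReal.coe_mul, lpTerm, lpDensity]
  congr 1
  field_simp

/-- The nonnegative functions in the unit ball of the dual of `L^q`. -/
def lpDual (a b : ℤ → ℝ) (θ : stateSpace M N) (q : ℝ) : Set (stateSpace M N → ℝ≥0) :=
  {g | ∀ f : stateSpace M N → ℝ, ∫⁻ i, ‖f i‖ₑ * g i ∂(symMeasure a b θ) ≤
    eLpNorm f (ENNReal.ofReal q) (symMeasure a b θ)}

include ha hb in
-- The norm is the supremum of its values over finite sets of states; on each of these the finite
-- duality is attained, and cutting `γ` off outside the set keeps the density in the dual unit ball.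
lemma iSup_lpDual {q : ℝ} (hq : 1 ≤ q) (f : stateSpace M N → ℝ) :
    ⨆ g ∈ lpDual a b θ q, ∫⁻ i, ‖f i‖ₑ * g i ∂(symMeasure a b θ) =
      eLpNorm f (ENNReal.ofReal q) (symMeasure a b θ) := by
  have hq0 : 0 < q := by linarith
  have hcoe : ∀ (ψ : stateSpace M N → ℝ≥0) (s : Finset (stateSpace M N)),
      (((∑ i ∈ s, ψ i ^ q) ^ (1 / q) : ℝ≥0) : ℝ≥0∞) =
        (∑ i ∈ s, (ψ i : ℝ≥0∞) ^ q) ^ (1 / q) := fun ψ s => by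
    rw [ENNReal.coe_rpow_of_nonneg _ (by positivity), ENNReal.ofNNReal_finsetSum]
    simp_rw [ENNReal.coe_rpow_of_nonneg _ hq0.le]
  have hsum : ∀ (f : stateSpace M N → ℝ) (γ : stateSpace M N → ℝ≥0)
      (s : Finset (stateSpace M N)),
      ∫⁻ i, ‖f i‖ₑ * lpDensity a b θ q ((s : Set (stateSpace M N)).indicator γ) i
        ∂(symMeasure a b θ) = ((∑ i ∈ s, lpTerm a b θ q f i * γ i : ℝ≥0) : ℝ≥0∞) := by
    intro f γ s
    rw [lintegral_mul_lpDensity ha hb, tsum_eq_sum (s := s), ENNReal.ofNNReal_finsetSum]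
    · refine Finset.sum_congr rfl fun i hi => ?_
      rw [Set.indicator_of_mem (Finset.mem_coe.2 hi), ENNReal.coe_mul]
    · intro i hi
      rw [Set.indicator_of_notMem (by simpa using hi), ENNReal.coe_zero, mul_zero]
  refine le_antisymm (iSup₂_le fun g hg => hg f) ?_
  rw [eLpNorm_eq_tsum_lpTerm θ hq, one_div, ENNReal.rpow_inv_le_iff hq0, ENNReal.tsum_eq_iSup_sum]
  refine iSup_le fun s => ?_
  rw [← ENNReal.rpow_inv_le_iff hq0, ← one_div]
  obtain ⟨γ, hγ, hγ'⟩ := exists_dual_finset s hq (lpTerm a b θ q f)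
  rw [← hcoe, ← hγ', ← hsum]
  refine le_iSup₂ (f := fun (g : stateSpace M N → ℝ≥0) (_ : g ∈ lpDual a b θ q) =>
    ∫⁻ i, ‖f i‖ₑ * g i ∂(symMeasure a b θ)) _ fun h => ?_
  rw [hsum, eLpNorm_eq_tsum_lpTerm θ hq]
  refine (ENNReal.coe_le_coe.2 (hγ _)).trans ?_
  rw [hcoe]
  gcongr
  exact ENNReal.sum_le_tsum s

include ha hb in
-- Each `lpTerm` is at most the whole norm, so any positive sequence `δ` with sum below `1` gives a
-- functional of norm at most `1`.
lemma exists_mem_lpDual_pos {q : ℝ} (hq : 1 ≤ q) :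
    ∃ g ∈ lpDual a b θ q, ∀ i, 0 < g i := by
  have hq0 : 0 < q := by linarith
  obtain ⟨δ, hδ, hsum⟩ := ENNReal.exists_pos_sum_of_countable one_ne_zero (stateSpace M N)
  refine ⟨lpDensity a b θ q δ, fun f => ?_, fun i => ?_⟩
  · rw [lintegral_mul_lpDensity ha hb, eLpNorm_eq_tsum_lpTerm θ hq]
    set X := (∑' i, (lpTerm a b θ q f i : ℝ≥0∞) ^ q) ^ (1 / q)
    have hX : ∀ i, (lpTerm a b θ q f i : ℝ≥0∞) ≤ X := fun i => by
      rw [← ENNReal.rpow_rpow_inv hq0.ne' (lpTerm a b θ q f i : ℝ≥0∞), ← one_div]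
      exact ENNReal.rpow_le_rpow
        (ENNReal.le_tsum (f := fun i => (lpTerm a b θ q f i : ℝ≥0∞) ^ q) i) (by positivity)
    calc ∑' i, (lpTerm a b θ q f i * δ i : ℝ≥0∞) ≤ ∑' i, X * δ i :=
          ENNReal.tsum_le_tsum fun i => by gcongr; exact hX i
      _ = X * ∑' i, (δ i : ℝ≥0∞) := ENNReal.tsum_mul_left
      _ ≤ X * 1 := by gcongr
      _ = X := mul_one X
  · have hw : 0 < (weight a b θ i).toNNReal := Real.toNNReal_pos.2 (weight_pos ha hb θ i.2)
    exact mul_pos (hδ i) (div_pos (NNReal.rpow_pos hw) hw)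

/-- `L^q(μ)` as a space of functions. -/
def lpFunctionSpace {q : ℝ} (hq : 1 ≤ q) :
    FunctionSpace (stateSpace M N) (symMeasure a b θ) where
  carrier :=
    { carrier := {f | eLpNorm f (ENNReal.ofReal q) (symMeasure a b θ) < ∞}
      add_mem' := fun {f h} hf hh => (MemLp.add ⟨Measurable.of_discrete.aestronglyMeasurable, hf⟩
        ⟨Measurable.of_discrete.aestronglyMeasurable, hh⟩).2
      zero_mem' := by simp
      smul_mem' := fun c f hf =>
        (MemLp.const_smul ⟨Measurable.of_discrete.aestronglyMeasurable, hf⟩ c).2 }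
  nrm := Seminorm.of
    (fun f => (eLpNorm (f : stateSpace M N → ℝ) (ENNReal.ofReal q) (symMeasure a b θ)).toReal)
    (fun f h => by
      rw [← ENNReal.toReal_add f.2.ne h.2.ne]
      exact ENNReal.toReal_mono (ENNReal.add_ne_top.2 ⟨f.2.ne, h.2.ne⟩)
        (eLpNorm_add_le Measurable.of_discrete.aestronglyMeasurable
          Measurable.of_discrete.aestronglyMeasurable (by simpa using hq)))
    (fun c f => by
      change (eLpNorm (c • (f : stateSpace M N → ℝ)) _ _).toReal = _
      rw [eLpNorm_const_smul, ENNReal.toReal_mul, toReal_enorm])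
  dual := lpDual a b θ q
  measurable_of_mem := fun _ _ => Measurable.of_discrete
  measurable_of_mem_dual := fun _ _ => Measurable.of_discrete
  ae_eq_zero_of_nrm_eq_zero := fun f hf => by
    have h0 : eLpNorm (f : stateSpace M N → ℝ) (ENNReal.ofReal q) (symMeasure a b θ) = 0 :=
      ((ENNReal.toReal_eq_zero_iff _).1 hf).resolve_right f.2.ne
    exact (eLpNorm_eq_zero_iff Measurable.of_discrete.aestronglyMeasurable
      (by simp; linarith)).1 h0
  indicator_mem := fun _ K hK => by
    have hμ : symMeasure a b θ K < ∞ := by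
      rw [← Set.biUnion_of_singleton K]
      refine measure_biUnion_lt_top hK.finite_of_discrete fun i _ => ?_
      rw [← Set.Icc_self, symMeasure_Icc]
      simp
    exact (memLp_indicator_const _ MeasurableSet.of_discrete _ (Or.inr hμ.ne)).2
  one_mem := fun h => by
    have : IsFiniteMeasure (symMeasure a b θ) := ⟨lt_top_iff_ne_top.2 h⟩
    exact (memLp_const (1 : ℝ)).2
  solid := fun h hh f _ hfh => (eLpNorm_mono_real hfh).trans_lt hh
  nrm_eq := fun f => by
    rw [iSup_lpDual ha hb θ hq]
    exact ENNReal.ofReal_toReal f.2.ne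

lemma lpFunctionSpace_isLp {q : ℝ} (hq : 1 ≤ q) :
    (lpFunctionSpace ha hb θ hq).IsLp (ENNReal.ofReal q) :=
  ⟨fun _ => ⟨fun h => ⟨Measurable.of_discrete, h⟩, fun h => h.2⟩,
    fun f => ENNReal.ofReal_toReal f.2.ne⟩

lemma lpFunctionSpace_hasLocallyPositive {q : ℝ} (hq : 1 ≤ q) :
    (lpFunctionSpace ha hb θ hq).HasLocallyPositive := by
  obtain ⟨g, hg, hpos⟩ := exists_mem_lpDual_pos ha hb θ hq
  refine ⟨g, hg, fun K hK => ?_⟩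
  rcases K.eq_empty_or_nonempty with rfl | hne
  · exact ⟨1, one_pos, by simp⟩
  · obtain ⟨i, -, hi⟩ := Set.exists_min_image K g hK.finite_of_discrete hne
    exact ⟨g i, hpos i, hi⟩

lemma lpFunctionSpace_extNorm {q : ℝ} (hq : 1 ≤ q) :
    (lpFunctionSpace ha hb θ hq).extNorm =
      fun f => eLpNorm f (ENNReal.ofReal q) (symMeasure a b θ) :=
  funext fun f => iSup_lpDual ha hb θ hq f

end Lp

end BirthDeath

end

theorem theorem8p2 (M N : WithTop ℤ) (a b : ℤ → ℝ)
    (ha : ∀ i ∈ BirthDeath.stateSpace M N, 0 < a i)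
    (hb : ∀ i ∈ BirthDeath.stateSpace M N, 0 < b i)
    (θ : BirthDeath.stateSpace M N) :
    -- the general case
    (∀ B : BirthDeath.FunctionSpace (BirthDeath.stateSpace M N) (BirthDeath.symMeasure a b θ),
      B.HasLocallyPositive →
        BirthDeath.isoConst a b θ B ≤ BirthDeath.optimalConst a b θ B.extNorm ∧
        BirthDeath.optimalConst a b θ B.extNorm ≤ 4 * BirthDeath.isoConst a b θ B) ∧
    -- the case of `L^{p/2}(μ)`, which is one of the function spaces of the general case
    (∀ p : ℝ, 2 ≤ p →
      (∃ B : BirthDeath.FunctionSpace (BirthDeath.stateSpace M N) (BirthDeath.symMeasure a b θ),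
        B.IsLp (ENNReal.ofReal (p / 2)) ∧ B.HasLocallyPositive) ∧
      (∀ B : BirthDeath.FunctionSpace (BirthDeath.stateSpace M N) (BirthDeath.symMeasure a b θ),
        B.IsLp (ENNReal.ofReal (p / 2)) →
          BirthDeath.isoConst a b θ B = BirthDeath.sobolevIsoConst a b θ p) ∧
      BirthDeath.sobolevIsoConst a b θ p ≤
        BirthDeath.optimalConst a b θ
          (fun f => eLpNorm f (ENNReal.ofReal (p / 2)) (BirthDeath.symMeasure a b θ)) ∧
      BirthDeath.optimalConst a b θ
          (fun f => eLpNorm f (ENNReal.ofReal (p / 2)) (BirthDeath.symMeasure a b θ)) ≤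
        4 * BirthDeath.sobolevIsoConst a b θ p) := by
  refine ⟨fun B hB => ⟨BirthDeath.isoConst_le_optimalConst ha hb θ B hB,
    BirthDeath.optimalConst_le_isoConst ha hb θ B⟩, fun p hp => ?_⟩
  have hq : 1 ≤ p / 2 := by linarith
  have hLp := BirthDeath.lpFunctionSpace_isLp ha hb θ hq
  have hpos := BirthDeath.lpFunctionSpace_hasLocallyPositive ha hb θ hq
  refine ⟨⟨_, hLp, hpos⟩, fun B hB => BirthDeath.isoConst_eq_sobolevIsoConst θ hp B hB, ?_⟩
  rw [← BirthDeath.isoConst_eq_sobolevIsoConst θ hp _ hLp,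
    ← BirthDeath.lpFunctionSpace_extNorm ha hb θ hq]
  exact ⟨BirthDeath.isoConst_le_optimalConst ha hb θ _ hpos,
    BirthDeath.optimalConst_le_isoConst ha hb θ _⟩
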